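/- Let $M$ be a Hausdorff smooth $n$-dimensional manifold (without boundary), let $\nabla$ be a smooth affine connection on $M$, and let $D$ be a smooth distribution of rank $p$ on $M$, i.e. a smooth rank-$p$ subbundle of $TM$. Say that $D$ is \emph{geodesically invariant} if for every geodesic $c:[a,b]\to M$ of $\nabla$ (a smooth curve with $\nabla_{\dot c}\dot c=0$), $\dot c(a)\in D_{c(a)}$ implies $\dot c(t)\in D_{c(t)}$ for all $t\in[a,b]$. Let $Z$ be the geodesic spray of $\nabla$, i.e. the vector field on $TM$ whose value at $v\in TM$ is the $\nabla$-horizontal lift of $v$ to $T_vTM$; in induced coordinates $(x^i,v^i)$ on $TM$, $$Z=v^i\frac{\partial}{\partial x^i}-\Gamma^i_{jk}v^jv^k\frac{\partial}{\partial v^i}.$$ Then $D$ is geodesically invariant if and only if $Z$ is tangent to $D$, regarded as a submanifold of $TM$; that is, if and only if $Z(v)\in T_vD$ for every $v\in D$. -/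

import Mathlib

open Set Bundle
open scoped Manifold ContDiff Topology

noncomputable section

namespace GeodesicInvariance

variable {E : Type*} [NormedAddCommGroup E] [NormedSpace ℝ E]
  {H : Type*} [TopologicalSpace H] {I : ModelWithCorners ℝ E H}
  {M : Type*} [TopologicalSpace M] [ChartedSpace H M]

/-! ### Geodesics of an affine connection -/

/-- The velocity `ċ(t)` of a curve `c` defined on `s ⊆ ℝ` (one-sided at the end points of an
interval). -/
def velocity (c : ℝ → M) (s : Set ℝ) (t : ℝ) : TangentSpace I (c t) :=
  mfderivWithin 𝓘(ℝ, ℝ) I c s t (1 : ℝ)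

variable [IsManifold I 1 M]

/-- The covariant derivative `(∇_ċ V)(t)` of a vector field `V` along a curve `c` defined on
`s ⊆ ℝ`. In the frame `(e_i)` of `TM` near `c t` given by the preferred trivialization at `c t`,
writing `V r = ∑ i, V^i(r) e_i(c r)`, it is `∑ i, (V^i)'(t) e_i(c t) + V^i(t) ∇_{ċ(t)} e_i`;
here `FiberBundle.extend E (V t)` is the local vector field `∑ i, V^i(t) e_i`. -/
def covDerivAlong (cov : CovariantDerivative I E (TangentSpace I : M → Type _))
    (c : ℝ → M) (s : Set ℝ) (V : (t : ℝ) → TangentSpace I (c t)) (t : ℝ) :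
    TangentSpace I (c t) :=
  (trivializationAt E (TangentSpace I : M → Type _) (c t)).symm (c t)
      (derivWithin (fun r ↦ (trivializationAt E (TangentSpace I : M → Type _) (c t)
        (⟨c r, V r⟩ : TangentBundle I M)).2) s t)
    + cov (FiberBundle.extend E (V t)) (c t) (velocity c s t)

/-- `c` is a (smooth) geodesic on `s ⊆ ℝ`: `∇_ċ ċ = 0` along `c`. -/
structure IsGeodesicOn (cov : CovariantDerivative I E (TangentSpace I : M → Type _))
    (c : ℝ → M) (s : Set ℝ) : Prop where
  contMDiffOn : ContMDiffOn 𝓘(ℝ, ℝ) I ∞ c s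
  covDerivAlong_velocity : ∀ t ∈ s, covDerivAlong cov c s (velocity c s) t = 0

/-! ### Distributions and geodesic invariance -/

/-- `D` is a smooth distribution of rank `p` on `M`: locally it is spanned by `p` smooth pointwise
linearly independent vector fields. -/
def IsSmoothDistribution (D : (x : M) → Submodule ℝ (TangentSpace I x)) (p : ℕ) : Prop :=
  ∀ x₀ : M, ∃ U : Set M, IsOpen U ∧ x₀ ∈ U ∧
    ∃ X : Fin p → (x : M) → TangentSpace I x,
      (∀ i, ContMDiffOn I I.tangent ∞ (fun x ↦ (⟨x, X i x⟩ : TangentBundle I M)) U) ∧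
      ∀ x ∈ U, LinearIndependent ℝ (fun i ↦ X i x) ∧
        D x = Submodule.span ℝ (range fun i ↦ X i x)

/-- A geodesic `c : [a, b] → M` with `ċ(a) ∈ D` has `ċ(t) ∈ D` for all `t ∈ [a, b]`. -/
def GeodesicallyInvariant (cov : CovariantDerivative I E (TangentSpace I : M → Type _))
    (D : (x : M) → Submodule ℝ (TangentSpace I x)) : Prop :=
  ∀ (a b : ℝ) (c : ℝ → M), a < b → IsGeodesicOn cov c (Icc a b) →
    velocity c (Icc a b) a ∈ D (c a) →
    ∀ t ∈ Icc a b, velocity c (Icc a b) t ∈ D (c t)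

/-- The distribution `D` as a subset of the tangent bundle. -/
def totalSet (D : (x : M) → Submodule ℝ (TangentSpace I x)) : Set (TangentBundle I M) :=
  {v | v.2 ∈ D v.proj}

/-! ### The geodesic spray -/

/-- The vertical lift of `w ∈ T_x M` at `v ∈ T_x M`: the velocity at `0` of `t ↦ v + t w`. -/
def verticalLift (v : TangentBundle I M) (w : TangentSpace I v.proj) :
    TangentSpace I.tangent v :=
  mfderiv 𝓘(ℝ, ℝ) I.tangent
    (fun t : ℝ ↦ (⟨v.proj, v.2 + t • w⟩ : TangentBundle I M)) 0 (1 : ℝ)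

/-- The horizontal lift to `T_v TM` of `w ∈ T_x M`, `x = π(v)`: for a vector field `X` near `x`
with `X(x) = v` it is `T_x X (w) - vlft_v (∇_w X)`, so that it equals `T_x X (w)` as soon as
`∇_w X = 0`. The choice of `X` is immaterial, see `horizontalLift_eq` below. -/
def horizontalLift (cov : CovariantDerivative I E (TangentSpace I : M → Type _))
    (v : TangentBundle I M) (w : TangentSpace I v.proj) : TangentSpace I.tangent v :=
  letI dX : TangentSpace I.tangent v := mfderiv I I.tangent
    (fun y ↦ (⟨y, FiberBundle.extend E v.2 y⟩ : TangentBundle I M)) v.proj w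
  dX - verticalLift v (cov (FiberBundle.extend E v.2) v.proj w)

/-- The geodesic spray of `∇`, a vector field on `TM`: `Z(v)` is the horizontal lift of `v` to
`T_v TM`, that is, the velocity of the parallel transport of `v` in the direction `v`. In induced
coordinates `Z = v^i ∂/∂x^i - Γ^i_{jk} v^j v^k ∂/∂v^i`. -/
def geodesicSpray (cov : CovariantDerivative I E (TangentSpace I : M → Type _))
    (v : TangentBundle I M) : TangentSpace I.tangent v :=
  horizontalLift cov v v.2

/-! ### Tangency to a subset -/

/-- The tangent vectors at `v` to an (embedded) submanifold `S` of `TM`: the velocities at `0` of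
smooth curves `(-ε, ε) → TM` through `v` that lie in `S`. -/
def tangentVectors (S : Set (TangentBundle I M)) (v : TangentBundle I M) :
    Set (TangentSpace I.tangent v) :=
  {ζ | ∃ (ε : ℝ) (γ : ℝ → TangentBundle I M), 0 < ε ∧ γ 0 = v ∧
    ContMDiffOn 𝓘(ℝ, ℝ) I.tangent ∞ γ (Ioo (-ε) ε) ∧ (∀ t ∈ Ioo (-ε) ε, γ t ∈ S) ∧
    (mfderiv 𝓘(ℝ, ℝ) I.tangent γ 0 (1 : ℝ) : TangentSpace I.tangent (γ 0)) = ζ}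

/-- The vector field `Z` on `TM` is tangent to the submanifold `S` of `TM`. -/
def IsTangentTo (Z : (v : TangentBundle I M) → TangentSpace I.tangent v)
    (S : Set (TangentBundle I M)) : Prop :=
  ∀ v ∈ S, Z v ∈ tangentVectors S v

/-! ### The definitions do not depend on the choices made in them -/

section
variable {E' : Type*} [NormedAddCommGroup E'] [NormedSpace ℝ E']
  {H' : Type*} [TopologicalSpace H'] {I' : ModelWithCorners ℝ E' H'}
  {N : Type*} [TopologicalSpace N] [ChartedSpace H' N] 

lemma triv_self (x : M) (u : TangentSpace I x) :
   (trivializationAt E (TangentSpace I : M → Type _) x (⟨x, u⟩ : TangentBundle I M)).2 = u := by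
  exact (tangentBundleCore I M).coordChange_self _ _ (mem_chart_source H x) _

lemma mfderiv_totalSpace {f : N → TangentBundle I M} {x₀ : N}
    (hf : MDifferentiableAt I' I.tangent f x₀) (w : TangentSpace I' x₀) :
    (mfderiv I' I.tangent f x₀ w : E × E) =
      ((mfderiv I' I (fun y ↦ (f y).proj) x₀ w : E),
       (mfderiv I' 𝓘(ℝ, E) (fun y ↦ (trivializationAt E (TangentSpace I : M → Type _)
          (f x₀).proj (f y)).2) x₀ w : E)) := by
  have h2 := (mdifferentiableAt_totalSpace I f).1 hf
  have h1 : ∀ᶠ y in 𝓝 x₀, (f y).proj ∈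
      (trivializationAt E (TangentSpace I : M → Type _) (f x₀).proj).baseSet :=
    ((FiberBundle.continuous_proj E (TangentSpace I)).continuousAt.comp hf.continuousAt)
      ((Trivialization.open_baseSet _).mem_nhds (FiberBundle.mem_baseSet_trivializationAt E _ _))
  rw [hf.mfderiv, h2.1.mfderiv, h2.2.mfderiv]
  have hx : extChartAt I' x₀ x₀ ∈ range I' := mem_range_self _
  have hu : UniqueDiffWithinAt ℝ (range I') (extChartAt I' x₀ x₀) := I'.uniqueDiffOn _ hx
  have key : writtenInExtChartAt I' I.tangent x₀ f =ᶠ[𝓝[range I'] (extChartAt I' x₀ x₀)]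
      fun z ↦ (writtenInExtChartAt I' I x₀ (fun y ↦ (f y).proj) z,
        writtenInExtChartAt I' 𝓘(ℝ, E) x₀ (fun y ↦ (trivializationAt E (TangentSpace I : M → Type _)
          (f x₀).proj (f y)).2) z) := by
    have := (continuousAt_extChartAt_symm (I := I') x₀).continuousWithinAt (s := range I')
    rw [ContinuousWithinAt, extChartAt_to_inv] at this
    filter_upwards [this.eventually h1] with z hz
    simp only [writtenInExtChartAt, FiberBundle.extChartAt, Function.comp_apply,
      PartialEquiv.trans_apply, PartialEquiv.prod_coe, PartialEquiv.refl_coe]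
    simp only [OpenPartialHomeomorph.coe_toPartialEquiv, Trivialization.coe_coe]
    rw [Trivialization.coe_fst' _ hz]
    rfl
  rw [key.fderivWithin_eq_of_mem hx,
    DifferentiableWithinAt.fderivWithin_prodMk h2.1.differentiableWithinAt_writtenInExtChartAt
      h2.2.differentiableWithinAt_writtenInExtChartAt hu]
  rfl

lemma verticalLift_eq (x : M) (a b : E) :
    (verticalLift (⟨x, a⟩ : TangentBundle I M) b : E × E) = ((0 : E), b) := by
  have e1 : ∀ t : ℝ, (trivializationAt E (TangentSpace I : M → Type _) x
      (⟨x, (a + t • b : E)⟩ : TangentBundle I M)).2 = (a + t • b : E) := fun t ↦ triv_self _ _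
  have hd : HasDerivAt (fun t : ℝ ↦ a + t • b) b 0 := by
    simpa using ((hasDerivAt_id (0 : ℝ)).smul_const b).const_add a
  have hf : MDifferentiableAt 𝓘(ℝ, ℝ) I.tangent
      (fun t : ℝ ↦ (⟨x, (a + t • b : E)⟩ : TangentBundle I M)) 0 := by
    rw [mdifferentiableAt_totalSpace]
    refine ⟨mdifferentiableAt_const, ?_⟩
    simp only [e1]
    exact hd.differentiableAt.mdifferentiableAt
  have := mfderiv_totalSpace hf (1 : ℝ)
  refine this.trans (Prod.ext ?_ ?_)
  · simp only [mfderiv_const]; rfl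
  · simp only [mfderiv_eq_fderiv]
    have h3 : HasFDerivAt (fun t : ℝ ↦ (trivializationAt E (TangentSpace I : M → Type _) x
      (⟨x, (a + t • b : E)⟩ : TangentBundle I M)).2) _ 0 :=
        hd.hasFDerivAt.congr_of_eventuallyEq (.of_forall e1)
    refine (DFunLike.congr_fun h3.fderiv (1 : ℝ)).trans ?_
    exact one_smul ℝ b

/-- The derivative at `x` of a vector field, read in the preferred trivialization at `x`. -/
def secDeriv (X : (y : M) → TangentSpace I y) (x : M) : E →L[ℝ] E :=
  mfderiv I 𝓘(ℝ, E) (fun y ↦ (trivializationAt E (TangentSpace I : M → Type _) x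
        (⟨y, X y⟩ : TangentBundle I M)).2) x

/-- `∇X` at `x`, as a map on the model space. -/
def covE (cov : CovariantDerivative I E (TangentSpace I : M → Type _))
    (X : (y : M) → TangentSpace I y) (x : M) : E →L[ℝ] E := cov X x

lemma mfderiv_section {X : (y : M) → TangentSpace I y} {x : M}
    (hX : MDifferentiableAt I I.tangent (fun y ↦ (⟨y, X y⟩ : TangentBundle I M)) x) (w : E) :
    (mfderiv I I.tangent (fun y ↦ (⟨y, X y⟩ : TangentBundle I M)) x w : E × E) =
      (w, secDeriv X x w) := by
  refine (mfderiv_totalSpace hX w).trans (Prod.ext ?_ rfl)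
  exact DFunLike.congr_fun (mfderiv_id (I := I) (x := x)) w

lemma horizontalLift_self (cov : CovariantDerivative I E (TangentSpace I : M → Type _))
    (x : M) (a w : E) :
    (horizontalLift cov (⟨x, a⟩ : TangentBundle I M) w : E × E) =
      (w, secDeriv (FiberBundle.extend E (show TangentSpace I x from a)) x w
         - covE cov (FiberBundle.extend E (show TangentSpace I x from a)) x w) := by
  have h0 := FiberBundle.mdifferentiableAt_extend (V := (TangentSpace I : M → Type _)) I E
    (show TangentSpace I x from a)
  have b2 := verticalLift_eq (I := I) x a (cov (FiberBundle.extend E (show TangentSpace I x from a)) x w)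
  unfold horizontalLift
  refine (congrArg₂ (fun p q : E × E ↦ p - q) (mfderiv_section h0 w) b2).trans ?_
  exact Prod.ext (sub_zero _) rfl

/-- The part of the derivative of a section seen in the preferred trivialization differs from the
covariant derivative by a tensor. -/
lemma tensorialAt_sub (cov : CovariantDerivative I E (TangentSpace I : M → Type _)) (x : M)
    (w : E) :
    TensorialAt I E (fun X : (y : M) → TangentSpace I y ↦ secDeriv X x w - covE cov X x w) x where
  smul {f σ} hf hσ := by
    have hσ' := (mdifferentiableAt_section I σ).1 hσ
    have h1 : covE cov (f • σ) x w = f x • covE cov σ x w + HSMul.hSMul (α := ℝ) (β := E) (mfderiv I 𝓘(ℝ, ℝ) f x w) (σ x) :=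
      DFunLike.congr_fun (cov.isCovariantDerivativeOnUniv.leibniz hσ hf) w
    have h2 : secDeriv (f • σ) x w = f x • secDeriv σ x w + HSMul.hSMul (α := ℝ) (β := E) (mfderiv I 𝓘(ℝ, ℝ) f x w) (σ x) := by
      have this : HasMFDerivAt I 𝓘(ℝ, E) (fun y ↦ f y •
          (trivializationAt E (TangentSpace I : M → Type _) x (⟨y, σ y⟩ : TangentBundle I M)).2) x _ :=
        ⟨hf.hasMFDerivAt.1.smul hσ'.hasMFDerivAt.1, hf.hasMFDerivAt.2.smul hσ'.hasMFDerivAt.2⟩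
      have h3 : (fun y ↦ (trivializationAt E (TangentSpace I : M → Type _) x
        (⟨y, (f • σ) y⟩ : TangentBundle I M)).2) =ᶠ[𝓝 x] (fun y ↦ f y • (trivializationAt E (TangentSpace I : M → Type _) x
        (⟨y, σ y⟩ : TangentBundle I M)).2) := by
        filter_upwards [(trivializationAt E (TangentSpace I : M → Type _) x).open_baseSet.mem_nhds
          (FiberBundle.mem_baseSet_trivializationAt E _ x)] with y hy
        exact ((trivializationAt E (TangentSpace I : M → Type _) x).linear ℝ hy).map_smul _ _
      have h4 := (this.congr_of_eventuallyEq h3).mfderiv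
      refine (DFunLike.congr_fun h4 w).trans ?_
      have hi := extChartAt_to_inv (I := I) x
      exact congrArg₂ (fun (r : ℝ) (z : E) ↦ r • secDeriv σ x w +
          HSMul.hSMul (α := ℝ) (β := E) (mfderiv I 𝓘(ℝ, ℝ) f x w) z) (congrArg f hi)
        ((congrArg (fun y ↦ (trivializationAt E (TangentSpace I : M → Type _) x
          (⟨y, σ y⟩ : TangentBundle I M)).2) hi).trans (triv_self x (σ x)))
    simp only [h1, h2]
    module
  add {σ σ'} hσ hσ' := by
    have hs := (mdifferentiableAt_section I σ).1 hσ
    have hs' := (mdifferentiableAt_section I σ').1 hσ'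
    have h1 : covE cov (σ + σ') x w = covE cov σ x w + covE cov σ' x w :=
      DFunLike.congr_fun (cov.isCovariantDerivativeOnUniv.add hσ hσ') w
    have h2 : secDeriv (σ + σ') x w = secDeriv σ x w + secDeriv σ' x w := by
      have := hs.hasMFDerivAt.add hs'.hasMFDerivAt
      have h3 : (fun y ↦ (trivializationAt E (TangentSpace I : M → Type _) x
        (⟨y, (σ + σ') y⟩ : TangentBundle I M)).2) =ᶠ[𝓝 x] (fun y ↦ (trivializationAt E (TangentSpace I : M → Type _) x
        (⟨y, σ y⟩ : TangentBundle I M)).2) + (fun y ↦ (trivializationAt E (TangentSpace I : M → Type _) x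
        (⟨y, σ' y⟩ : TangentBundle I M)).2) := by
        filter_upwards [(trivializationAt E (TangentSpace I : M → Type _) x).open_baseSet.mem_nhds
          (FiberBundle.mem_baseSet_trivializationAt E _ x)] with y hy
        exact ((trivializationAt E (TangentSpace I : M → Type _) x).linear ℝ hy).map_add _ _
      have h4 := (this.congr_of_eventuallyEq h3).mfderiv
      exact (DFunLike.congr_fun h4 w)
    simp only [h1, h2]
    module

lemma triv_symm_self (x : M) (u : E) :
   (trivializationAt E (TangentSpace I : M → Type _) x).symm x u = (u : E) := by
  have := (trivializationAt E (TangentSpace I : M → Type _) x).symm_apply_apply_mk (FiberBundle.mem_baseSet_trivializationAt' x) (show TangentSpace I x from u)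
  rw [triv_self] at this
  exact this

lemma triv_extend (x : M) (u : TangentSpace I x) (y : M)
    (hy : y ∈ (trivializationAt E (TangentSpace I : M → Type _) x).baseSet) :
    (trivializationAt E (TangentSpace I : M → Type _) x
      (⟨y, FiberBundle.extend E u y⟩ : TangentBundle I M)).2 = u := by
  have h := (trivializationAt E (TangentSpace I : M → Type _) x).apply_mk_symm hy
    ((trivializationAt E (TangentSpace I : M → Type _) x (⟨x, u⟩ : TangentBundle I M)).2)
  exact (congrArg Prod.snd h).trans (triv_self x u)

variable [FiniteDimensional ℝ E] [IsManifold I 2 M]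

/-- The horizontal lift is `T_x X (w) - vlft (∇_w X)` for every vector field `X` through the given
point that is differentiable there. -/
lemma horizontalLift_eq (cov : CovariantDerivative I E (TangentSpace I : M → Type _))
    (x : M) (X : (y : M) → TangentSpace I y)
    (hX : MDifferentiableAt I I.tangent (fun y ↦ (⟨y, X y⟩ : TangentBundle I M)) x)
    (w : TangentSpace I x) :
    horizontalLift cov ⟨x, X x⟩ w =
      mfderiv I I.tangent (fun y ↦ (⟨y, X y⟩ : TangentBundle I M)) x w
        - verticalLift ⟨x, X x⟩ (cov X x w) := by
  have h0 := FiberBundle.mdifferentiableAt_extend (V := (TangentSpace I : M → Type _)) I E (X x)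
  have hp := (tensorialAt_sub cov x w).pointwise h0 hX
    (FiberBundle.extend_apply_self ..)
  have b1 := verticalLift_eq (I := I) x (X x) (cov X x w)
  refine (horizontalLift_self cov x (X x) w).trans ?_
  refine Eq.trans ?_ (congrArg₂ (fun p q : E × E ↦ p - q) (mfderiv_section hX w) b1).symm
  exact Prod.ext (sub_zero _).symm hp


/-- If `X(x) = v` and `∇_v X = 0`, then `Z(v) = T_x X (v)`. With `X = ∑ i, ξ^i s_i` for a frame
`(s_i)` parallel at `x` in the direction `v`, this is the description of the spray through standard
horizontal vector fields on the frame bundle. -/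
lemma geodesicSpray_eq_of_parallel (cov : CovariantDerivative I E (TangentSpace I : M → Type _))
    (x : M) (X : (y : M) → TangentSpace I y)
    (hX : MDifferentiableAt I I.tangent (fun y ↦ (⟨y, X y⟩ : TangentBundle I M)) x)
    (hpar : cov X x (X x) = 0) :
    geodesicSpray cov ⟨x, X x⟩ =
      mfderiv I I.tangent (fun y ↦ (⟨y, X y⟩ : TangentBundle I M)) x (X x) := by
  have h : (verticalLift (⟨x, X x⟩ : TangentBundle I M) (0 : E) : E × E) = 0 :=
    verticalLift_eq (I := I) x (X x) 0
  refine (horizontalLift_eq cov x X hX (X x)).trans ?_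
  rw [hpar]
  exact (congrArg (fun q : E × E ↦ (_ : E × E) - q) h).trans (sub_zero _)

/-- If `V = X ∘ c` for a vector field `X` on `M`, then `∇_ċ V = ∇_ċ X`. -/
lemma covDerivAlong_comp (cov : CovariantDerivative I E (TangentSpace I : M → Type _))
    (c : ℝ → M) (s : Set ℝ) (t : ℝ) (hs : UniqueDiffWithinAt ℝ s t) (X : (y : M) → TangentSpace I y)
    (hc : MDifferentiableWithinAt 𝓘(ℝ, ℝ) I c s t)
    (hX : MDifferentiableAt I I.tangent (fun y ↦ (⟨y, X y⟩ : TangentBundle I M)) (c t)) :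
    covDerivAlong cov c s (fun r ↦ X (c r)) t = cov X (c t) (velocity c s t) := by
  have h0 := FiberBundle.mdifferentiableAt_extend (V := (TangentSpace I : M → Type _)) I E (X (c t))
  have hp := (tensorialAt_sub cov (c t) (velocity (I := I) c s t)).pointwise h0 hX
    (FiberBundle.extend_apply_self ..)
  have hz : secDeriv (FiberBundle.extend E (X (c t))) (c t) (velocity (I := I) c s t) = (0 : E) := by
    have h3 : (fun y ↦ (trivializationAt E (TangentSpace I : M → Type _) (c t)
        (⟨y, FiberBundle.extend E (X (c t)) y⟩ : TangentBundle I M)).2) =ᶠ[𝓝 (c t)] fun y ↦ (X (c t) : E) := by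
        filter_upwards [(trivializationAt E (TangentSpace I : M → Type _) (c t)).open_baseSet.mem_nhds
          (FiberBundle.mem_baseSet_trivializationAt E _ (c t))] with y hy
        exact triv_extend (c t) (X (c t)) y hy
    unfold secDeriv
    have h4 : HasMFDerivAt I 𝓘(ℝ, E) (fun y ↦ (trivializationAt E (TangentSpace I : M → Type _) (c t)
        (⟨y, FiberBundle.extend E (X (c t)) y⟩ : TangentBundle I M)).2) (c t) (0 : E →L[ℝ] E) :=
      (hasMFDerivAt_const (I := I) (I' := 𝓘(ℝ, E)) (M' := E) (X (c t)) (c t)).congr_of_eventuallyEq h3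
    exact DFunLike.congr_fun h4.mfderiv _
  have hX' := (mdifferentiableAt_section I X).1 hX
  have h6 : derivWithin (fun r ↦ (trivializationAt E (TangentSpace I : M → Type _) (c t)
        (⟨c r, X (c r)⟩ : TangentBundle I M)).2) s t = secDeriv X (c t) (velocity (I := I) c s t) := by
    unfold secDeriv velocity
    generalize hg : (fun y ↦ (trivializationAt E (TangentSpace I : M → Type _) (c t)
        (⟨y, X y⟩ : TangentBundle I M)).2) = g at hX' ⊢
    have hg' : (fun r ↦ (trivializationAt E (TangentSpace I : M → Type _) (c t)
        (⟨c r, X (c r)⟩ : TangentBundle I M)).2) = g ∘ c := by rw [← hg]; rfl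
    rw [hg']
    have := HasMFDerivAt.comp_hasMFDerivWithinAt t hX'.hasMFDerivAt hc.hasMFDerivWithinAt
    let A : E →L[ℝ] E := mfderiv I 𝓘(ℝ, E) g (c t)
    let B : ℝ →L[ℝ] E := mfderivWithin 𝓘(ℝ, ℝ) I c s t
    have h5 : HasFDerivWithinAt (g ∘ c) (A.comp B) s t := hasMFDerivWithinAt_iff_hasFDerivWithinAt.1 this
    rw [← fderivWithin_derivWithin]
    exact DFunLike.congr_fun (h5.fderivWithin hs) (1:ℝ)
  unfold covDerivAlong
  rw [h6]
  refine (congrArg (fun z : E ↦ z + covE cov (FiberBundle.extend E (X (c t))) (c t) (velocity (I := I) c s t)) (triv_symm_self (c t) _)).trans ?_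
  simp only [hz] at hp
  have : ∀ a b d : E, 0 - b = a - d → a + b = d := by
    intro a b d h
    have := congrArg (fun z ↦ z + b + d) h
    simp only [zero_sub] at this
    rw [show a + b = a - d + b + d by abel, ← h]; abel
  exact this _ _ _ hp
end

end GeodesicInvariance
end

/-!
Near any point, `D` is the kernel of a `C¹` family of projections `A(x)`. Along a geodesic with
position `x` and velocity `v` in a chart, the derivative of `u = A(x) v` is a quadratic form in `v`,
namely `Q(v, v)` with `Q(u, w) = DA(x)(u) w - A(x) Γ(x)(u, w)`. Differentiating the local equation
`A(x) v = 0` of `D` along curves in `D` shows that, if `Z` is tangent to `D`, then `Q(w, w) = 0` for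
all `w ∈ ker A(x)`. Hence `u` satisfies a homogeneous linear ODE and vanishes identically as soon as
it vanishes somewhere; connectedness of the interval makes this global.

Conversely, let `D` be geodesically invariant, let `v ∈ D`, and let `c` be the geodesic with
`ċ(0) = v`. Its velocity stays in `D`, for negative times by reversing `c`. So `t ↦ ċ(t)` is a curve
in `D`, and its derivative at `0` is `Z(v)`.
-/

noncomputable section

namespace GeodesicInvariance

section LinearODE

variable {F : Type*} [NormedAddCommGroup F] [NormedSpace ℝ F]

lemma eq_zero_of_hasDerivWithinAt_clm {B : ℝ → F →L[ℝ] F} {u : ℝ → F} {a b t₀ t : ℝ}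
    (hB : ContinuousOn B (Icc a b))
    (hu : ∀ t ∈ Icc a b, HasDerivWithinAt u (B t (u t)) (Icc a b) t)
    (ht₀ : t₀ ∈ Icc a b) (hu₀ : u t₀ = 0) (ht : t ∈ Icc a b) : u t = 0 := by
  obtain ⟨K, hK⟩ := isCompact_Icc.bddAbove_image hB.nnnorm
  have hLip : ∀ r ∈ Icc a b, LipschitzOnWith K (B r) univ := fun r hr ↦
    ((B r).lipschitz.weaken (hK (mem_image_of_mem _ hr))).lipschitzOnWith
  have hcont : ContinuousOn u (Icc a b) := fun r hr ↦ (hu r hr).continuousWithinAt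
  have hzero : ∀ r (s : Set ℝ), HasDerivWithinAt (fun _ ↦ (0 : F)) (B r 0) s r := fun r s ↦ by
    simpa only [map_zero] using hasDerivWithinAt_const r s (0 : F)
  rcases le_total t₀ t with h | h
  · have hsub : Icc t₀ b ⊆ Icc a b := Icc_subset_Icc_left ht₀.1
    refine ODE_solution_unique_of_mem_Icc_right (v := fun r ↦ B r) (g := fun _ ↦ 0)
      (fun r hr ↦ hLip r (hsub (Ico_subset_Icc_self hr))) (hcont.mono hsub) (fun r hr ↦ ?_)
      (fun _ _ ↦ mem_univ _) continuousOn_const (fun r _ ↦ hzero r _) (fun _ _ ↦ mem_univ _)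
      hu₀ ⟨h, ht.2⟩
    have hr' := hsub (Ico_subset_Icc_self hr)
    exact (hu r hr').mono_of_mem_nhdsWithin (Icc_mem_nhdsGE_of_mem ⟨hr'.1, hr.2⟩)
  · have hsub : Icc a t₀ ⊆ Icc a b := Icc_subset_Icc_right ht₀.2
    refine ODE_solution_unique_of_mem_Icc_left (v := fun r ↦ B r) (g := fun _ ↦ 0)
      (fun r hr ↦ hLip r (hsub (Ioc_subset_Icc_self hr))) (hcont.mono hsub) (fun r hr ↦ ?_)
      (fun _ _ ↦ mem_univ _) continuousOn_const (fun r _ ↦ hzero r _) (fun _ _ ↦ mem_univ _)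
      hu₀ ⟨ht.1, h⟩
    have hr' := hsub (Ioc_subset_Icc_self hr)
    exact (hu r hr').mono_of_mem_nhdsWithin (Icc_mem_nhdsLE_of_mem ⟨hr.1, hr'.2⟩)

lemma exists_contDiffOn_forall_hasDerivAt_Ioo [CompleteSpace F] {f : F → F} {O : Set F} {z : F}
    (hO : IsOpen O) (hf : ContDiffOn ℝ ∞ f O) (hz : z ∈ O) :
    ∃ ε > 0, ∃ α : ℝ → F, α 0 = z ∧ ContDiffOn ℝ ∞ α (Ioo (-ε) ε) ∧
      MapsTo α (Ioo (-ε) ε) O ∧ ∀ t ∈ Ioo (-ε) ε, HasDerivAt α (f (α t)) t := by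
  obtain ⟨α, hα₀, δ, hδ, hα⟩ := ((hf.contDiffAt (hO.mem_nhds hz)).of_le
    (by norm_cast)).exists_forall_mem_closedBall_exists_eq_forall_mem_Ioo_hasDerivAt₀ 0
  have hcont : ContinuousAt α 0 := (hα 0 (by simp [hδ])).continuousAt
  have hgood : ∀ᶠ t in 𝓝 (0 : ℝ), α t ∈ O ∧ HasDerivAt α (f (α t)) t :=
    (hcont.eventually_mem (hO.mem_nhds (hα₀ ▸ hz))).and
      (Filter.eventually_of_mem (Ioo_mem_nhds (by linarith) (by linarith)) hα)
  obtain ⟨ε, hε, hball⟩ := Metric.nhds_basis_closedBall.eventually_iff.1 hgood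
  rw [Real.closedBall_eq_Icc, zero_sub, zero_add] at hball
  have hsmooth : ContDiffOn ℝ ∞ α (Icc (-ε) ε) :=
    ODE.contDiffOn_enat_Icc_of_hasDerivWithinAt (f := fun _ ↦ f) (n := ⊤)
      (hf.comp contDiff_snd.contDiffOn fun q hq ↦ hq.2)
      (fun t ht ↦ (hball ht).2.hasDerivWithinAt) (fun t ht ↦ (hball ht).1)
  exact ⟨ε, hε, α, hα₀, hsmooth.mono Ioo_subset_Icc_self,
    fun t ht ↦ (hball (Ioo_subset_Icc_self ht)).1, fun t ht ↦ (hball (Ioo_subset_Icc_self ht)).2⟩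

end LinearODE

section GeodesicEquation

variable {E : Type*} [NormedAddCommGroup E] [NormedSpace ℝ E]
  {Γ : E → E →L[ℝ] E →L[ℝ] E} {A : E → E →L[ℝ] E} {x v : ℝ → E}
  {s : Set ℝ}

/-- The position `x` and the velocity `v` of a solution on `s` of the geodesic equation
`x'' = -Γ(x)(x', x')`, written as a first order system, with derivatives taken within `s`. -/
structure IsGeodesicSolutionOn (Γ : E → E →L[ℝ] E →L[ℝ] E) (x v : ℝ → E) (s : Set ℝ) : Prop where
  hasDerivWithinAt_position : ∀ t ∈ s, HasDerivWithinAt x (v t) s t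
  hasDerivWithinAt_velocity : ∀ t ∈ s, HasDerivWithinAt v (-Γ (x t) (v t) (v t)) s t

namespace IsGeodesicSolutionOn

lemma mono {s' : Set ℝ} (h : IsGeodesicSolutionOn Γ x v s) (hs : s' ⊆ s) :
    IsGeodesicSolutionOn Γ x v s' where
  hasDerivWithinAt_position t ht := (h.hasDerivWithinAt_position t (hs ht)).mono hs
  hasDerivWithinAt_velocity t ht := (h.hasDerivWithinAt_velocity t (hs ht)).mono hs

lemma comp_neg (h : IsGeodesicSolutionOn Γ x v s) :
    IsGeodesicSolutionOn Γ (fun t ↦ x (-t)) (fun t ↦ -v (-t)) (Neg.neg ⁻¹' s) where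
  hasDerivWithinAt_position t ht := by
    simpa only [neg_smul, one_smul, Function.comp_def] using
      (h.hasDerivWithinAt_position (-t) ht).scomp t
      (hasDerivAt_neg t).hasDerivWithinAt (mapsTo_preimage _ _)
  hasDerivWithinAt_velocity t ht := by
    simpa only [neg_smul, one_smul, map_neg, neg_apply, neg_neg, Function.comp_def] using
      ((h.hasDerivWithinAt_velocity (-t) ht).scomp t
        (hasDerivAt_neg t).hasDerivWithinAt (mapsTo_preimage _ _)).fun_neg

end IsGeodesicSolutionOn

/-- The bilinear map `(u, w) ↦ DA(z)(u) w - A(z) Γ(z)(u, w)`. On the diagonal it is the rate of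
change of `A(x) x'` along the solution of the geodesic equation through `z` with velocity `u = w`;
if it vanishes for all `w ∈ ker A(z)`, then `ker A` is invariant to first order. -/
def invarianceDefect (Γ : E → E →L[ℝ] E →L[ℝ] E) (A : E → E →L[ℝ] E) (z : E) :
    E →L[ℝ] E →L[ℝ] E :=
  fderiv ℝ A z - ContinuousLinearMap.compL ℝ E E E (A z) ∘L Γ z

lemma continuousAt_invarianceDefect {z : E} (hΓ : ContinuousAt Γ z) (hA : ContDiffAt ℝ 1 A z) :
    ContinuousAt (invarianceDefect Γ A) z := by
  have hDA : ContinuousAt (fderiv ℝ A) z := (hA.fderiv_right (m := 0) le_rfl).continuousAt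
  have hcompL : ContinuousAt (fun y ↦ ContinuousLinearMap.compL ℝ E E E (A y)) z :=
    (ContinuousLinearMap.compL ℝ E E E).continuous.continuousAt.comp hA.continuousAt
  have hAΓ : ContinuousAt (fun y ↦ ContinuousLinearMap.compL ℝ E E E (A y) ∘L Γ y) z :=
    hcompL.clm_comp hΓ
  have : ContinuousSub (E →L[ℝ] E →L[ℝ] E) := IsTopologicalAddGroup.to_continuousSub
  exact hDA.sub hAΓ

lemma hasDerivWithinAt_clm_apply_velocity {t : ℝ} (hA : DifferentiableAt ℝ A (x t))
    (hx : HasDerivWithinAt x (v t) s t)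
    (hv : HasDerivWithinAt v (-Γ (x t) (v t) (v t)) s t) :
    HasDerivWithinAt (fun r ↦ A (x r) (v r)) (invarianceDefect Γ A (x t) (v t) (v t)) s t := by
  have hderiv := (hA.hasFDerivAt.comp_hasDerivWithinAt t hx).clm_apply hv
  rw [map_neg, ← sub_eq_add_neg] at hderiv
  exact hderiv

/-- Writing `v = u + (v - u)` with `u = A(x) v` and `v - u ∈ ker A(x)`, and `Q` for the defect,
`u' = Q(v, v) = Q(u, v) + Q(v - u, u)` is linear in `u`. -/
lemma IsGeodesicSolutionOn.apply_eq_zero {a b t₀ t : ℝ} (h : IsGeodesicSolutionOn Γ x v (Icc a b))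
    (hΓ : ∀ t ∈ Icc a b, ContinuousAt Γ (x t)) (hA : ∀ t ∈ Icc a b, ContDiffAt ℝ 1 A (x t))
    (hidem : ∀ t ∈ Icc a b, IsIdempotentElem (A (x t)))
    (hdefect : ∀ t ∈ Icc a b, ∀ w, A (x t) w = 0 → invarianceDefect Γ A (x t) w w = 0)
    (ht₀ : t₀ ∈ Icc a b) (h₀ : A (x t₀) (v t₀) = 0) (ht : t ∈ Icc a b) : A (x t) (v t) = 0 := by
  let u : ℝ → E := fun t ↦ A (x t) (v t)
  let Q : ℝ → E →L[ℝ] E →L[ℝ] E := fun t ↦ invarianceDefect Γ A (x t)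
  have hx : ContinuousOn x (Icc a b) := fun t ht ↦
    (h.hasDerivWithinAt_position t ht).continuousWithinAt
  have hv : ContinuousOn v (Icc a b) := fun t ht ↦
    (h.hasDerivWithinAt_velocity t ht).continuousWithinAt
  have hu : ContinuousOn u (Icc a b) := ContinuousOn.clm_apply
    (fun t ht ↦ (hA t ht).continuousAt.comp_continuousWithinAt (hx t ht)) hv
  have hQ : ContinuousOn Q (Icc a b) := fun t ht ↦
    (continuousAt_invarianceDefect (hΓ t ht) (hA t ht)).comp_continuousWithinAt (hx t ht)
  have hQflip : ContinuousOn (fun t ↦ (Q t).flip) (Icc a b) :=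
    (ContinuousLinearMap.flipₗᵢ ℝ E E E).continuous.comp_continuousOn hQ
  have hlinear : ∀ t ∈ Icc a b, Q t (v t) (v t) = ((Q t).flip (v t) + Q t (v t - u t)) (u t) := by
    intro t ht
    have hker : A (x t) (v t - u t) = 0 :=
      (map_sub _ _ _).trans (sub_eq_zero.2 (DFunLike.congr_fun (hidem t ht).eq (v t)).symm)
    calc Q t (v t) (v t)
        = Q t (u t) (v t) + Q t (v t - u t) (u t) + Q t (v t - u t) (v t - u t) := by
          simp only [map_sub, sub_apply]
          abel
      _ = ((Q t).flip (v t) + Q t (v t - u t)) (u t) := by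
          rw [hdefect t ht _ hker, add_zero]
          rfl
  have hu' : ∀ t ∈ Icc a b,
      HasDerivWithinAt u (((Q t).flip (v t) + Q t (v t - u t)) (u t)) (Icc a b) t := fun t ht ↦
    hlinear t ht ▸ hasDerivWithinAt_clm_apply_velocity ((hA t ht).differentiableAt one_ne_zero)
      (h.hasDerivWithinAt_position t ht) (h.hasDerivWithinAt_velocity t ht)
  exact eq_zero_of_hasDerivWithinAt_clm ((hQflip.clm_apply hv).add (hQ.clm_apply (hv.sub hu)))
    hu' ht₀ h₀ ht

lemma exists_isGeodesicSolutionOn_Ioo [CompleteSpace E] {O : Set E} (hO : IsOpen O)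
    (hΓ : ContDiffOn ℝ ∞ Γ O) {z : E} (hz : z ∈ O) (u : E) :
    ∃ ε > 0, ∃ x v : ℝ → E, x 0 = z ∧ v 0 = u ∧ ContDiffOn ℝ ∞ x (Ioo (-ε) ε) ∧
      MapsTo x (Ioo (-ε) ε) O ∧ IsGeodesicSolutionOn Γ x v (Ioo (-ε) ε) := by
  have hf : ContDiffOn ℝ ∞ (fun q : E × E ↦ (q.2, -Γ q.1 q.2 q.2)) (O ×ˢ univ) :=
    contDiff_snd.contDiffOn.prodMk (((hΓ.comp contDiff_fst.contDiffOn fun q hq ↦ hq.1).clm_apply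
      contDiff_snd.contDiffOn).clm_apply contDiff_snd.contDiffOn).neg
  obtain ⟨ε, hε, α, hα₀, hsmooth, hmaps, hα⟩ :=
    exists_contDiffOn_forall_hasDerivAt_Ioo (hO.prod isOpen_univ) hf (z := (z, u)) ⟨hz, mem_univ _⟩
  exact ⟨ε, hε, fun t ↦ (α t).1, fun t ↦ (α t).2, congrArg Prod.fst hα₀, congrArg Prod.snd hα₀,
    contDiff_fst.comp_contDiffOn hsmooth, fun t ht ↦ (hmaps ht).1,
    fun t ht ↦ HasDerivAt.hasDerivWithinAt (hα t ht).fst,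
    fun t ht ↦ HasDerivAt.hasDerivWithinAt (hα t ht).snd⟩

end GeodesicEquation

section Projection

variable {E E' F : Type*} [NormedAddCommGroup E] [NormedSpace ℝ E]
  [NormedAddCommGroup E'] [NormedSpace ℝ E'] [NormedAddCommGroup F] [NormedSpace ℝ F]
  {z₀ : E'} {n : WithTop ℕ∞}

/-- If `L` is a left inverse of `b z₀`, then `L ∘ b z` is invertible for `z` near `z₀`, and
`1 - b z ∘ (L ∘ b z)⁻¹ ∘ L` is a projection with kernel the range of `b z`. -/
lemma exists_contDiffAt_projection_ker_eq_range [CompleteSpace F] {b : E' → F →L[ℝ] E}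
    (hb : ContDiffAt ℝ n b z₀) {L : E →L[ℝ] F} (hL : L ∘L b z₀ = 1) :
    ∃ A : E' → E →L[ℝ] E, ContDiffAt ℝ n A z₀ ∧
      ∀ᶠ z in 𝓝 z₀, IsIdempotentElem (A z) ∧ ∀ w, A z w = 0 ↔ w ∈ range (b z) := by
  have hLb : ContDiffAt ℝ n (fun z ↦ L ∘L b z) z₀ := contDiffAt_const.clm_comp hb
  have hinv : ContDiffAt ℝ n (fun z ↦ Ring.inverse (L ∘L b z)) z₀ := by
    refine ContDiffAt.comp (g := Ring.inverse) z₀ ?_ hLb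
    rw [hL]
    exact contDiffAt_ringInverse ℝ (1 : (F →L[ℝ] F)ˣ)
  have hunit : ∀ᶠ z in 𝓝 z₀, IsUnit (L ∘L b z) :=
    hLb.continuousAt.eventually_mem (Units.isOpen.mem_nhds (by simp [hL]))
  refine ⟨fun z ↦ 1 - b z ∘L Ring.inverse (L ∘L b z) ∘L L,
    contDiffAt_const.sub (hb.clm_comp (hinv.clm_comp contDiffAt_const)),
    hunit.mono fun z hz ↦ ?_⟩
  have hfix : ∀ a, b z (Ring.inverse (L ∘L b z) (L (b z a))) = b z a := fun a ↦
    congrArg (b z) (DFunLike.congr_fun (Ring.inverse_mul_cancel _ hz) a)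
  refine ⟨IsIdempotentElem.one_sub (ContinuousLinearMap.ext fun w ↦ hfix _),
    fun w ↦ ⟨fun hw ↦ ⟨_, (sub_eq_zero.1 hw).symm⟩, ?_⟩⟩
  rintro ⟨a, rfl⟩
  exact sub_eq_zero.2 (hfix a).symm

lemma exists_contDiffAt_projection_ker_eq_span [FiniteDimensional ℝ E] {ι : Type*} [Finite ι]
    {ξ : ι → E' → E} (hξ : ∀ i, ContDiffAt ℝ n (ξ i) z₀)
    (hli : LinearIndependent ℝ fun i ↦ ξ i z₀) :
    ∃ A : E' → E →L[ℝ] E, ContDiffAt ℝ n A z₀ ∧ ∀ᶠ z in 𝓝 z₀, IsIdempotentElem (A z) ∧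
      ∀ w, A z w = 0 ↔ w ∈ Submodule.span ℝ (range fun i ↦ ξ i z) := by
  have := Fintype.ofFinite ι
  let b : E' → (ι → ℝ) →L[ℝ] E := fun z ↦
    ∑ i, (ContinuousLinearMap.proj (R := ℝ) (φ := fun _ : ι ↦ ℝ) i).smulRight (ξ i z)
  have hb_apply : ∀ z a, b z a = ∑ i, a i • ξ i z := fun z a ↦ by simp [b]
  have hb : ContDiffAt ℝ n b z₀ := ContDiffAt.sum fun i _ ↦ contDiffAt_const.smulRight (hξ i)
  have hinj : (b z₀ : (ι → ℝ) →ₗ[ℝ] E).ker = ⊥ := LinearMap.ker_eq_bot'.2 fun a ha ↦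
    funext (Fintype.linearIndependent_iff.1 hli a ((hb_apply z₀ a).symm.trans ha))
  obtain ⟨L, hL⟩ := LinearMap.exists_leftInverse_of_injective _ hinj
  obtain ⟨A, hA, hAb⟩ := exists_contDiffAt_projection_ker_eq_range hb
    (L := L.toContinuousLinearMap) (ContinuousLinearMap.ext fun a ↦ LinearMap.congr_fun hL a)
  refine ⟨A, hA, hAb.mono fun z hz ↦ ⟨hz.1, fun w ↦ (hz.2 w).trans ?_⟩⟩
  simp only [Submodule.mem_span_range_iff_exists_fun, mem_range, hb_apply]

end Projection

section Coordinates

variable {E : Type*} [NormedAddCommGroup E] [NormedSpace ℝ E]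
  {H : Type*} [TopologicalSpace H] {I : ModelWithCorners ℝ E H}
  {M : Type*} [TopologicalSpace M] [ChartedSpace H M] [IsManifold I ∞ M]
  {x₀ y : M} {s : Set ℝ} {t : ℝ}

/-- The fibre coordinates `(w^i)` of `w ∈ T_y M` induced by the preferred chart at `x₀`. They are
`0` by convention if `y` is outside the domain of that chart. -/
def fiberCoord (x₀ y : M) : TangentSpace I y →L[ℝ] E :=
  (trivializationAt E (TangentSpace I : M → Type _) x₀).continuousLinearMapAt ℝ y

/-- The vector field with constant coefficients `u` in the preferred chart at `x₀`, and `0` outside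
the domain of that chart. -/
def constField (x₀ : M) (u : E) (y : M) : TangentSpace I y :=
  (trivializationAt E (TangentSpace I : M → Type _) x₀).symmL ℝ y u

lemma fiberCoord_eq_trivializationAt (hy : y ∈ (chartAt H x₀).source) (w : TangentSpace I y) :
    fiberCoord x₀ y w =
      (trivializationAt E (TangentSpace I : M → Type _) x₀ (⟨y, w⟩ : TangentBundle I M)).2 :=
  congrFun (Trivialization.coe_linearMapAt_of_mem (R := ℝ) _ hy) w

lemma fiberCoord_self (w : TangentSpace I y) : fiberCoord y y w = w :=
  (fiberCoord_eq_trivializationAt (mem_chart_source H y) w).trans (triv_self y w)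

lemma fiberCoord_constField (hy : y ∈ (chartAt H x₀).source) (u : E) :
    fiberCoord (I := I) x₀ y (constField x₀ u y) = u :=
  Trivialization.continuousLinearMapAt_symmL _ hy u

lemma constField_fiberCoord (hy : y ∈ (chartAt H x₀).source) (w : TangentSpace I y) :
    constField x₀ (fiberCoord x₀ y w) y = w :=
  Trivialization.symmL_continuousLinearMapAt _ hy w

lemma fiberCoord_injective (hy : y ∈ (chartAt H x₀).source) :
    Function.Injective (fiberCoord (I := I) x₀ y) :=
  Function.LeftInverse.injective (constField_fiberCoord hy)

lemma constField_add (x₀ : M) (u w : E) :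
    constField (I := I) x₀ (u + w) = constField x₀ u + constField x₀ w :=
  funext fun _ ↦ map_add _ u w

lemma constField_smul (x₀ : M) (r : ℝ) (u : E) :
    constField (I := I) x₀ (r • u) = r • constField x₀ u :=
  funext fun _ ↦ map_smul _ r u

lemma mfderiv_extChartAt_eq_fiberCoord (hy : y ∈ (chartAt H x₀).source) :
    mfderiv I 𝓘(ℝ, E) (extChartAt I x₀) y = fiberCoord x₀ y :=
  (TangentBundle.continuousLinearMapAt_trivializationAt hy).symm

lemma contMDiffAt_fiberCoord {v : TangentBundle I M} (hv : v.proj ∈ (chartAt H x₀).source) :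
    ContMDiffAt I.tangent 𝓘(ℝ, E) ∞ (fun w : TangentBundle I M ↦ fiberCoord x₀ w.proj w.2) v := by
  have h := ((Trivialization.contMDiffAt_iff (IB := I) (n := ∞) (f := id)
    (e := trivializationAt E (TangentSpace I : M → Type _) x₀)
    ((Trivialization.mem_source _).2 hv)).1 contMDiffAt_id).2
  refine h.congr_of_eventuallyEq ?_
  filter_upwards [(FiberBundle.continuous_proj E (TangentSpace I : M → Type _)).continuousAt
    ((chartAt H x₀).open_source.mem_nhds hv)] with w hw
  exact fiberCoord_eq_trivializationAt hw w.2

lemma contMDiffOn_constField (x₀ : M) (u : E) :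
    ContMDiffOn I I.tangent ∞ (fun y ↦ (⟨y, constField x₀ u y⟩ : TangentBundle I M))
      (chartAt H x₀).source := by
  refine ((trivializationAt E (TangentSpace I : M → Type _)
    x₀).contMDiffOn_section_baseSet_iff).2 ?_
  exact (contMDiffOn_const (c := u)).congr fun y hy ↦
    (fiberCoord_eq_trivializationAt hy _).symm.trans (fiberCoord_constField hy u)

lemma mdifferentiableAt_constField (hy : y ∈ (chartAt H x₀).source) (u : E) :
    MDifferentiableAt I I.tangent
      (fun y ↦ (⟨y, constField x₀ u y⟩ : TangentBundle I M)) y :=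
  ((contMDiffOn_constField x₀ u).contMDiffAt
    ((chartAt H x₀).open_source.mem_nhds hy)).mdifferentiableAt (by simp)

/-- The components `dv^i` of a tangent vector of `TM` in the coordinates `(x^i, v^i)` induced by the
preferred chart at `x₀`. -/
def fiberCoordDeriv (x₀ : M) (v : TangentBundle I M) : TangentSpace I.tangent v →L[ℝ] E :=
  mfderiv I.tangent 𝓘(ℝ, E) (fun w : TangentBundle I M ↦ fiberCoord x₀ w.proj w.2) v

lemma tangentSpace_tangentBundle_ext {v : TangentBundle I M} {ζ ζ' : TangentSpace I.tangent v}
    (hproj : mfderiv I.tangent I (TotalSpace.proj : TangentBundle I M → M) v ζ =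
      mfderiv I.tangent I (TotalSpace.proj : TangentBundle I M → M) v ζ')
    (hfiber : fiberCoordDeriv v.proj v ζ = fiberCoordDeriv v.proj v ζ') : ζ = ζ' := by
  have hcoord : (fun w : TangentBundle I M ↦ fiberCoord v.proj w.proj w.2) =ᶠ[𝓝 v]
      fun w ↦ (trivializationAt E (TangentSpace I : M → Type _) v.proj w).2 := by
    filter_upwards [(FiberBundle.continuous_proj E (TangentSpace I : M → Type _)).continuousAt
      ((chartAt H v.proj).open_source.mem_nhds (mem_chart_source H v.proj))] with w hw
    exact fiberCoord_eq_trivializationAt hw w.2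
  have hsplit : ∀ η : TangentSpace I.tangent v, (η : E × E) =
      ((mfderiv I.tangent I (TotalSpace.proj : TangentBundle I M → M) v η : E),
        fiberCoordDeriv v.proj v η) := fun η ↦ by
    rw [fiberCoordDeriv, hcoord.mfderiv_eq]
    exact (DFunLike.congr_fun (mfderiv_id (I := I.tangent) (x := v)) η).symm.trans
      (mfderiv_totalSpace (f := id) mdifferentiableAt_id η)
  exact (hsplit ζ).trans ((Prod.ext hproj hfiber).trans (hsplit ζ').symm)

end Coordinates

section Lifts

variable {E : Type*} [NormedAddCommGroup E] [NormedSpace ℝ E]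
  {H : Type*} [TopologicalSpace H] {I : ModelWithCorners ℝ E H}
  {M : Type*} [TopologicalSpace M] [ChartedSpace H M] {s : Set ℝ} {t : ℝ}

lemma hasDerivWithinAt_comp_velocity {F : Type*} [NormedAddCommGroup F] [NormedSpace ℝ F]
    {f : M → F} {c : ℝ → M} (hf : MDifferentiableAt I 𝓘(ℝ, F) f (c t))
    (hc : MDifferentiableWithinAt 𝓘(ℝ, ℝ) I c s t) :
    HasDerivWithinAt (fun r ↦ f (c r)) (mfderiv I 𝓘(ℝ, F) f (c t) (velocity c s t)) s t :=
  let A : E →L[ℝ] F := mfderiv I 𝓘(ℝ, F) f (c t)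
  let B : ℝ →L[ℝ] E := mfderivWithin 𝓘(ℝ, ℝ) I c s t
  have h : HasFDerivWithinAt (fun r ↦ f (c r)) (A ∘L B) s t :=
    hasMFDerivWithinAt_iff_hasFDerivWithinAt.1
      (hf.hasMFDerivAt.comp_hasMFDerivWithinAt t hc.hasMFDerivWithinAt)
  h.hasDerivWithinAt

variable [IsManifold I ∞ M] {x₀ : M}

lemma velocity_proj {γ : ℝ → TangentBundle I M} (hs : UniqueDiffWithinAt ℝ s t)
    (hγ : MDifferentiableWithinAt 𝓘(ℝ, ℝ) I.tangent γ s t) :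
    velocity (fun r ↦ (γ r).proj) s t =
      mfderiv I.tangent I (TotalSpace.proj : TangentBundle I M → M) (γ t) (velocity γ s t) :=
  DFunLike.congr_fun (mfderiv_comp_mfderivWithin t
    ((contMDiffAt_proj (TangentSpace I : M → Type _) (n := ∞)).mdifferentiableAt (by simp)) hγ
    hs.uniqueMDiffWithinAt) (1 : ℝ)

lemma hasDerivWithinAt_extChartAt_comp {c : ℝ → M} (hc : MDifferentiableWithinAt 𝓘(ℝ, ℝ) I c s t)
    (hx : c t ∈ (chartAt H x₀).source) :
    HasDerivWithinAt (fun r ↦ extChartAt I x₀ (c r))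
      (fiberCoord (I := I) x₀ (c t) (velocity c s t)) s t := by
  rw [← mfderiv_extChartAt_eq_fiberCoord hx]
  exact hasDerivWithinAt_comp_velocity (mdifferentiableAt_extChartAt hx) hc

lemma mdifferentiableAt_add_smul (v : TangentBundle I M) (w : TangentSpace I v.proj) (t : ℝ) :
    MDifferentiableAt 𝓘(ℝ, ℝ) I.tangent
      (fun r : ℝ ↦ (⟨v.proj, v.2 + r • w⟩ : TangentBundle I M)) t := by
  refine (mdifferentiableAt_totalSpace I _).2 ⟨mdifferentiableAt_const, ?_⟩
  let u : E := v.2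
  let u' : E := w
  have hline : ∀ r : ℝ, (trivializationAt E (TangentSpace I : M → Type _) v.proj
      (⟨v.proj, v.2 + r • w⟩ : TangentBundle I M)).2 = u + r • u' := fun r ↦ triv_self _ _
  simp only [hline]
  have hd : DifferentiableAt ℝ (fun r : ℝ ↦ u + r • u') t :=
    (differentiableAt_id.smul_const u').const_add u
  exact hd.mdifferentiableAt

lemma mfderiv_verticalLift {E' : Type*} [NormedAddCommGroup E'] [NormedSpace ℝ E']
    {H' : Type*} [TopologicalSpace H'] {J : ModelWithCorners ℝ E' H'}
    {N : Type*} [TopologicalSpace N] [ChartedSpace H' N] {f : TangentBundle I M → N}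
    {v : TangentBundle I M} (hf : MDifferentiableAt I.tangent J f v) (w : TangentSpace I v.proj) :
    (mfderiv I.tangent J f v (verticalLift v w) : E') =
      mfderiv 𝓘(ℝ, ℝ) J (fun r : ℝ ↦ f ⟨v.proj, v.2 + r • w⟩) 0 (1 : ℝ) := by
  have hzero : (⟨v.proj, v.2 + (0 : ℝ) • w⟩ : TangentBundle I M) = v :=
    congrArg (TotalSpace.mk v.proj) (by rw [zero_smul, add_zero])
  have hcomp := mfderiv_comp_of_eq hf (mdifferentiableAt_add_smul v w 0) hzero
  let T : TangentBundle I M → (E × E →L[ℝ] E') := fun p ↦ mfderiv I.tangent J f p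
  have hbase : T ⟨v.proj, v.2 + (0 : ℝ) • w⟩ = T v := congrArg T hzero
  exact (DFunLike.congr_fun hbase (verticalLift v w)).symm.trans
    (DFunLike.congr_fun hcomp (1 : ℝ)).symm

lemma mfderiv_proj_verticalLift (v : TangentBundle I M) (w : TangentSpace I v.proj) :
    mfderiv I.tangent I (TotalSpace.proj : TangentBundle I M → M) v (verticalLift v w) = 0 := by
  refine (mfderiv_verticalLift ((contMDiffAt_proj (TangentSpace I : M → Type _)
    (n := ∞)).mdifferentiableAt (by simp)) w).trans ?_
  exact DFunLike.congr_fun (mfderiv_const (c := v.proj)) (1 : ℝ)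

lemma fiberCoordDeriv_verticalLift {v : TangentBundle I M}
    (hv : v.proj ∈ (chartAt H x₀).source) (w : TangentSpace I v.proj) :
    fiberCoordDeriv x₀ v (verticalLift v w) = fiberCoord x₀ v.proj w := by
  have hline : HasDerivAt (fun r : ℝ ↦ fiberCoord x₀ v.proj (v.2 + r • w))
      (fiberCoord x₀ v.proj w) 0 := by
    simpa only [map_add, map_smul, one_smul, id] using
      ((hasDerivAt_id (0 : ℝ)).smul_const (fiberCoord x₀ v.proj w)).const_add
        (fiberCoord x₀ v.proj v.2)
  refine (mfderiv_verticalLift ((contMDiffAt_fiberCoord hv).mdifferentiableAt (by simp)) w).trans ?_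
  rw [mfderiv_eq_fderiv]
  exact hline.deriv

lemma hasDerivWithinAt_fiberCoord_comp {γ : ℝ → TangentBundle I M}
    (hγ : MDifferentiableWithinAt 𝓘(ℝ, ℝ) I.tangent γ s t)
    (hx : (γ t).proj ∈ (chartAt H x₀).source) :
    HasDerivWithinAt (fun r ↦ fiberCoord x₀ (γ r).proj (γ r).2)
      (fiberCoordDeriv x₀ (γ t) (velocity γ s t)) s t :=
  hasDerivWithinAt_comp_velocity ((contMDiffAt_fiberCoord hx).mdifferentiableAt (by simp)) hγ

end Lifts

section HorizontalLift

variable {E : Type*} [NormedAddCommGroup E] [NormedSpace ℝ E]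
  {H : Type*} [TopologicalSpace H] {I : ModelWithCorners ℝ E H}
  {M : Type*} [TopologicalSpace M] [ChartedSpace H M] [IsManifold I ∞ M]
  {cov : CovariantDerivative I E (TangentSpace I : M → Type _)}
  {x₀ y : M} {s : Set ℝ} {t : ℝ}

lemma cov_extend (u : TangentSpace I y) :
    cov (FiberBundle.extend E u) y = cov (constField y (show E from u)) y := by
  refine cov.isCovariantDerivativeOnUniv.congr_of_eventuallyEq
    (FiberBundle.mdifferentiableAt_extend I E u)
    (mdifferentiableAt_constField (mem_chart_source H y) (show E from u)) Filter.univ_mem ?_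
  filter_upwards [(chartAt H y).open_source.mem_nhds (mem_chart_source H y)] with z hz
  rw [← constField_fiberCoord hz (FiberBundle.extend E u z), fiberCoord_eq_trivializationAt hz]
  exact congrArg (fun w : E ↦ constField (I := I) y w z) (triv_extend y u z hz)

lemma fiberCoord_covDerivAlong {c : ℝ → M} {V : (r : ℝ) → TangentSpace I (c r)}
    (hs : UniqueDiffWithinAt ℝ s t)
    (hγ : MDifferentiableWithinAt 𝓘(ℝ, ℝ) I.tangent
      (fun r ↦ (⟨c r, V r⟩ : TangentBundle I M)) s t) :
    fiberCoord (c t) (c t) (covDerivAlong cov c s V t) =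
      fiberCoordDeriv (c t) ⟨c t, V t⟩
          (velocity (fun r ↦ (⟨c r, V r⟩ : TangentBundle I M)) s t) +
        fiberCoord (c t) (c t)
          (cov (constField (c t) (show E from V t)) (c t) (velocity c s t)) := by
  have hmem := mem_chart_source H (c t)
  have hcoord : ∀ᶠ r in 𝓝[s] t, fiberCoord (c t) (c r) (V r) =
      (trivializationAt E (TangentSpace I : M → Type _) (c t)
        (⟨c r, V r⟩ : TangentBundle I M)).2 := by
    filter_upwards [((FiberBundle.continuous_proj E (TangentSpace I : M → Type _)
      ).continuousAt.comp_continuousWithinAt hγ.continuousWithinAt).preimage_mem_nhdsWithin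
        ((chartAt H (c t)).open_source.mem_nhds hmem)] with r hr
    exact fiberCoord_eq_trivializationAt hr _
  have hderiv : derivWithin (fun r ↦ (trivializationAt E (TangentSpace I : M → Type _) (c t)
        (⟨c r, V r⟩ : TangentBundle I M)).2) s t = fiberCoordDeriv (c t) ⟨c t, V t⟩
          (velocity (fun r ↦ (⟨c r, V r⟩ : TangentBundle I M)) s t) :=
    ((hasDerivWithinAt_fiberCoord_comp hγ hmem).congr_of_eventuallyEq
      (hcoord.mono fun _ h ↦ h.symm) (fiberCoord_eq_trivializationAt hmem _).symm).derivWithin hs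
  rw [covDerivAlong, map_add, hderiv, cov_extend]
  congr 1
  rw [fiberCoord_self]
  exact triv_symm_self _ _

variable [FiniteDimensional ℝ E]

lemma mfderiv_horizontalLift_section {E' : Type*} [NormedAddCommGroup E'] [NormedSpace ℝ E']
    {H' : Type*} [TopologicalSpace H'] {J : ModelWithCorners ℝ E' H'}
    {N : Type*} [TopologicalSpace N] [ChartedSpace H' N] {f : TangentBundle I M → N}
    {X : (y : M) → TangentSpace I y}
    (hX : MDifferentiableAt I I.tangent (fun y ↦ (⟨y, X y⟩ : TangentBundle I M)) y)
    (hf : MDifferentiableAt I.tangent J f ⟨y, X y⟩) (w : TangentSpace I y) :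
    mfderiv I.tangent J f ⟨y, X y⟩ (horizontalLift cov ⟨y, X y⟩ w) =
      mfderiv I J (fun y ↦ f ⟨y, X y⟩) y w -
        mfderiv I.tangent J f ⟨y, X y⟩ (verticalLift ⟨y, X y⟩ (cov X y w)) := by
  rw [horizontalLift_eq cov y X hX w, map_sub]
  congr 1
  exact (DFunLike.congr_fun (mfderiv_comp y hf hX) w).symm

lemma mfderiv_proj_horizontalLift (v : TangentBundle I M) (w : TangentSpace I v.proj) :
    mfderiv I.tangent I (TotalSpace.proj : TangentBundle I M → M) v (horizontalLift cov v w) =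
      w := by
  obtain ⟨y, u⟩ := v
  obtain ⟨u, rfl⟩ : ∃ u' : E, constField y u' y = u :=
    ⟨_, constField_fiberCoord (mem_chart_source H y) u⟩
  rw [mfderiv_horizontalLift_section (mdifferentiableAt_constField (mem_chart_source H y) u)
    ((contMDiffAt_proj (TangentSpace I : M → Type _) (n := ∞)).mdifferentiableAt (by simp)),
    mfderiv_proj_verticalLift, sub_zero]
  exact DFunLike.congr_fun mfderiv_id w

lemma fiberCoordDeriv_horizontalLift {v : TangentBundle I M}
    (hv : v.proj ∈ (chartAt H x₀).source) (w : TangentSpace I v.proj) :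
    fiberCoordDeriv x₀ v (horizontalLift cov v w) =
      -fiberCoord x₀ v.proj (cov (constField x₀ (fiberCoord x₀ v.proj v.2)) v.proj w) := by
  obtain ⟨y, u⟩ := v
  obtain ⟨u, rfl⟩ : ∃ u' : E, constField x₀ u' y = u := ⟨_, constField_fiberCoord hv u⟩
  have hconst : (fun y ↦ fiberCoord (I := I) x₀ y (constField x₀ u y)) =ᶠ[𝓝 y] fun _ ↦ u := by
    filter_upwards [(chartAt H x₀).open_source.mem_nhds hv] with z hz
    exact fiberCoord_constField hz u
  have hzero : mfderiv I 𝓘(ℝ, E) (fun y ↦ fiberCoord (I := I) x₀ y (constField x₀ u y)) y w =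
      (0 : E) := by
    rw [hconst.mfderiv_eq]
    exact DFunLike.congr_fun mfderiv_const w
  refine (mfderiv_horizontalLift_section (mdifferentiableAt_constField hv u)
    ((contMDiffAt_fiberCoord hv).mdifferentiableAt (by simp)) w).trans ?_
  refine (congrArg₂ (fun a b : E ↦ a - b) hzero (fiberCoordDeriv_verticalLift hv _)).trans ?_
  rw [zero_sub, fiberCoord_constField hv]

lemma velocity_eq_horizontalLift_add_verticalLift {c : ℝ → M} {V : (r : ℝ) → TangentSpace I (c r)}
    (hs : UniqueDiffWithinAt ℝ s t)
    (hγ : MDifferentiableWithinAt 𝓘(ℝ, ℝ) I.tangent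
      (fun r ↦ (⟨c r, V r⟩ : TangentBundle I M)) s t) :
    velocity (fun r ↦ (⟨c r, V r⟩ : TangentBundle I M)) s t =
      horizontalLift cov ⟨c t, V t⟩ (velocity c s t) +
        verticalLift ⟨c t, V t⟩ (covDerivAlong cov c s V t) := by
  have hmem := mem_chart_source H (c t)
  refine tangentSpace_tangentBundle_ext ?_ ?_
  · rw [map_add, mfderiv_proj_horizontalLift, mfderiv_proj_verticalLift, add_zero]
    exact (velocity_proj hs hγ).symm
  · rw [map_add, fiberCoordDeriv_verticalLift hmem, fiberCoordDeriv_horizontalLift hmem,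
      fiberCoord_covDerivAlong hs hγ, fiberCoord_self (I := I) (V t)]
    abel

end HorizontalLift

section Christoffel

variable {E : Type*} [NormedAddCommGroup E] [NormedSpace ℝ E]
  {H : Type*} [TopologicalSpace H] {I : ModelWithCorners ℝ E H}
  {M : Type*} [TopologicalSpace M] [ChartedSpace H M] [IsManifold I ∞ M]
  {x₀ y : M} {U : Set M}

section Bundle

variable {F : Type*} [NormedAddCommGroup F] [NormedSpace ℝ F] {V : M → Type*}
  [TopologicalSpace (TotalSpace F V)] [∀ x, AddCommGroup (V x)] [∀ x, Module ℝ (V x)]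
  [∀ x, TopologicalSpace (V x)] [FiberBundle F V] [VectorBundle ℝ F V]
  [FiniteDimensional ℝ E] [T2Space M]

lemma exists_contMDiff_section_eventuallyEq {X : (x : M) → V x} {n : ℕ∞} (hU : U ∈ 𝓝 y)
    (hX : CMDiff[U] n (T% X)) :
    ∃ X' : (x : M) → V x, CMDiff n (T% X') ∧ ∀ᶠ z in 𝓝 y, X' z = X z := by
  obtain ⟨ψ, -, hψ⟩ := (SmoothBumpFunction.nhds_basis_tsupport (I := I) y).mem_iff.1
    (interior_mem_nhds.2 hU)
  refine ⟨(ψ : M → ℝ) • X, ContMDiffOn.smul_section_of_tsupport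
    (ψ.contMDiff.of_le (mod_cast le_top)).contMDiffOn isOpen_interior hψ
    (hX.mono interior_subset), ?_⟩
  filter_upwards [ψ.eventuallyEq_one] with z hz
  simp [hz]

variable [∀ x, IsTopologicalAddGroup (V x)] [∀ x, ContinuousSMul ℝ (V x)]

/-- A connection of class `C^∞` is only required to map *global* smooth sections to smooth ones; a
local section is first replaced by a global one with the same germ. -/
lemma contMDiffAt_cov (cov : CovariantDerivative I F V)
    [CovariantDerivative.ContMDiffCovariantDerivative cov ∞] {X : (x : M) → V x}
    (hU : U ∈ 𝓝 y) (hX : CMDiff[U] ∞ (T% X)) :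
    ContMDiffAt I (I.prod 𝓘(ℝ, E →L[ℝ] F)) ∞
      (fun z ↦ (⟨z, cov X z⟩ : TotalSpace (E →L[ℝ] F) fun z ↦ TangentSpace I z →L[ℝ] V z)) y := by
  obtain ⟨X', hX', hXX'⟩ := exists_contMDiff_section_eventuallyEq (n := ⊤) hU hX
  have hcov := (CovariantDerivative.ContMDiffCovariantDerivative.contMDiff
    (cov := cov) (k := ∞)).contMDiff (σ := X') hX'.contMDiffOn
  refine (hcov.contMDiffAt Filter.univ_mem).congr_of_eventuallyEq ?_
  filter_upwards [hXX'.eventually_nhds, eventually_mem_nhds_iff.2 hU] with z hz hzU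
  exact congrArg (TotalSpace.mk z) (cov.isCovariantDerivativeOnUniv.congr_of_eventuallyEq
    ((hX.contMDiffAt hzU).mdifferentiableAt (by simp)) (hX'.mdifferentiable (by simp) z)
    Filter.univ_mem (hz.mono fun _ h ↦ h.symm))

end Bundle

variable (cov : CovariantDerivative I E (TangentSpace I : M → Type _))

/-- In the coordinates of the preferred chart at `x₀`, the covariant derivative at `y` of the
constant field `u`, as a function of the direction: `w ↦ Γ^i_{jk} w^j u^k`. -/
def christoffelForm (x₀ y : M) (u : E) : E →L[ℝ] E :=
  fiberCoord x₀ y ∘L cov (constField x₀ u) y ∘L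
    (trivializationAt E (TangentSpace I : M → Type _) x₀).symmL ℝ y

variable {cov}

lemma christoffelForm_add (hy : y ∈ (chartAt H x₀).source) (u u' : E) :
    christoffelForm cov x₀ y (u + u') =
      christoffelForm cov x₀ y u + christoffelForm cov x₀ y u' := by
  have h : cov (constField x₀ (u + u')) y =
      cov (constField x₀ u) y + cov (constField x₀ u') y := by
    rw [constField_add]
    exact cov.isCovariantDerivativeOnUniv.add (mdifferentiableAt_constField hy u)
      (mdifferentiableAt_constField hy u')
  exact ContinuousLinearMap.ext fun w ↦
    (congrArg (fiberCoord x₀ y) (DFunLike.congr_fun h _)).trans (map_add _ _ _)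

lemma christoffelForm_smul (hy : y ∈ (chartAt H x₀).source) (r : ℝ) (u : E) :
    christoffelForm cov x₀ y (r • u) = r • christoffelForm cov x₀ y u := by
  have h : cov (constField x₀ (r • u)) y = r • cov (constField x₀ u) y := by
    rw [constField_smul]
    exact cov.isCovariantDerivativeOnUniv.smul_const r (mdifferentiableAt_constField hy u)
  exact ContinuousLinearMap.ext fun w ↦
    (congrArg (fiberCoord x₀ y) (DFunLike.congr_fun h _)).trans (map_smul _ _ _)

variable [FiniteDimensional ℝ E]

variable (cov) in
/-- The Christoffel symbols of `cov` in the preferred chart at `x₀`, as a function of the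
coordinates `z` of a point: the bilinear map `(u, w) ↦ Γ^i_{jk} w^j u^k`. It is defined through its
values on a basis, so that it is bilinear also for `z` outside the target of the chart. -/
def chartChristoffel (x₀ : M) (z : E) : E →L[ℝ] E →L[ℝ] E :=
  (Module.finBasis ℝ E).constrL fun i ↦
    christoffelForm cov x₀ ((extChartAt I x₀).symm z) (Module.finBasis ℝ E i)

lemma chartChristoffel_extChartAt (hy : y ∈ (chartAt H x₀).source) (u w : E) :
    chartChristoffel cov x₀ (extChartAt I x₀ y) u w =
      fiberCoord x₀ y (cov (constField x₀ u) y (constField x₀ w y)) := by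
  have hinv : (extChartAt I x₀).symm (extChartAt I x₀ y) = y :=
    (extChartAt I x₀).left_inv (by rwa [extChartAt_source])
  let B : E →ₗ[ℝ] E →L[ℝ] E :=
    { toFun := christoffelForm cov x₀ y
      map_add' := christoffelForm_add hy
      map_smul' := christoffelForm_smul hy }
  have hB : (chartChristoffel cov x₀ (extChartAt I x₀ y) : E →ₗ[ℝ] E →L[ℝ] E) = B := by
    refine (Module.finBasis ℝ E).ext fun i ↦ ?_
    rw [chartChristoffel, hinv]
    exact (Module.finBasis ℝ E).constrL_basis (christoffelForm cov x₀ y ∘ Module.finBasis ℝ E) i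
  exact DFunLike.congr_fun (LinearMap.congr_fun hB u) w

lemma contDiffOn_chartChristoffel [T2Space M]
    [CovariantDerivative.ContMDiffCovariantDerivative cov ∞] (x₀ : M) :
    ContDiffOn ℝ ∞ (chartChristoffel cov x₀) (extChartAt I x₀).target := by
  refine contDiffOn_clm_apply.2 fun u ↦ contDiffOn_clm_apply.2 fun w ↦ ?_
  rw [← contMDiffOn_iff_contDiffOn]
  have hcoord : ContMDiffOn I 𝓘(ℝ, E) ∞
      (fun y ↦ fiberCoord (I := I) x₀ y (cov (constField x₀ u) y (constField x₀ w y)))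
      (chartAt H x₀).source := by
    intro y hy
    have hnhds := (chartAt H x₀).open_source.mem_nhds hy
    have happly := (contMDiffAt_cov cov hnhds (contMDiffOn_constField x₀ u)).clm_bundle_apply
      (x := y) ((contMDiffOn_constField x₀ w).contMDiffAt hnhds)
    exact ((contMDiffAt_fiberCoord (I := I) (v := ⟨y, cov (constField x₀ u) y
      (constField x₀ w y)⟩) hy).comp y happly).contMDiffWithinAt
  have hsource : MapsTo (extChartAt I x₀).symm (extChartAt I x₀).target (chartAt H x₀).source :=
    fun z hz ↦ extChartAt_source I x₀ ▸ (extChartAt I x₀).map_target hz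
  refine (hcoord.comp (contMDiffOn_extChartAt_symm x₀) hsource).congr fun z hz ↦ ?_
  simpa only [(extChartAt I x₀).right_inv hz, Function.comp_apply] using
    chartChristoffel_extChartAt (cov := cov) (hsource hz) u w

end Christoffel

section GeodesicFlow

variable {E : Type*} [NormedAddCommGroup E] [NormedSpace ℝ E]
  {H : Type*} [TopologicalSpace H] {I : ModelWithCorners ℝ E H}
  {M : Type*} [TopologicalSpace M] [ChartedSpace H M] [IsManifold I ∞ M]
  {cov : CovariantDerivative I E (TangentSpace I : M → Type _)}
  {x₀ : M} {γ : ℝ → TangentBundle I M} {c : ℝ → M} {x v : ℝ → E} {s : Set ℝ} {t : ℝ}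

lemma contMDiffOn_velocity (hs : UniqueDiffOn ℝ s) (hc : ContMDiffOn 𝓘(ℝ, ℝ) I ∞ c s) :
    ContMDiffOn 𝓘(ℝ, ℝ) I.tangent ∞
      (fun t ↦ (⟨c t, velocity c s t⟩ : TangentBundle I M)) s := by
  have hunit : ContMDiff 𝓘(ℝ, ℝ) 𝓘(ℝ, ℝ).tangent ∞
      (fun t : ℝ ↦ (⟨t, (1 : ℝ)⟩ : TangentBundle 𝓘(ℝ, ℝ) ℝ)) :=
    contMDiff_vectorSpace_iff_contDiff.2 contDiff_const
  exact (hc.contMDiffOn_tangentMapWithin (m := ∞) (by simp) hs.uniqueMDiffOn).comp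
    hunit.contMDiffOn fun t ht ↦ ht

lemma velocity_extChartAt_symm_comp {u : E} (hs : UniqueDiffWithinAt ℝ s t)
    (hxs : MapsTo x s (extChartAt I x₀).target) (ht : t ∈ s) (hx : HasDerivWithinAt x u s t) :
    velocity (I := I) (fun r ↦ (extChartAt I x₀).symm (x r)) s t =
      constField x₀ u ((extChartAt I x₀).symm (x t)) := by
  have hsource : (extChartAt I x₀).symm (x t) ∈ (chartAt H x₀).source :=
    extChartAt_source I x₀ ▸ (extChartAt I x₀).map_target (hxs ht)
  have hc : MDifferentiableWithinAt 𝓘(ℝ, ℝ) I (fun r ↦ (extChartAt I x₀).symm (x r)) s t :=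
    ((contMDiffOn_extChartAt_symm (I := I) (n := ∞) x₀).mdifferentiableOn
      (by simp) _ (hxs ht)).comp t hx.differentiableWithinAt.mdifferentiableWithinAt hxs
  have hx' : HasDerivWithinAt x (fiberCoord (I := I) x₀ ((extChartAt I x₀).symm (x t))
      (velocity (fun r ↦ (extChartAt I x₀).symm (x r)) s t)) s t :=
    (hasDerivWithinAt_extChartAt_comp hc hsource).congr
      (fun r hr ↦ ((extChartAt I x₀).right_inv (hxs hr)).symm)
      ((extChartAt I x₀).right_inv (hxs ht)).symm
  rw [← hs.eq_deriv _ hx' hx, constField_fiberCoord hsource]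

variable [FiniteDimensional ℝ E]

lemma hasDerivWithinAt_extChartAt_of_velocity_eq_geodesicSpray (hs : UniqueDiffWithinAt ℝ s t)
    (hγ : MDifferentiableWithinAt 𝓘(ℝ, ℝ) I.tangent γ s t)
    (hZ : velocity γ s t = geodesicSpray cov (γ t)) (hx : (γ t).proj ∈ (chartAt H x₀).source) :
    HasDerivWithinAt (fun r ↦ extChartAt I x₀ (γ r).proj)
      (fiberCoord x₀ (γ t).proj (γ t).2) s t := by
  have hvel : velocity (fun r ↦ (γ r).proj) s t = (γ t).2 := by
    rw [velocity_proj hs hγ, hZ]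
    exact mfderiv_proj_horizontalLift _ _
  rw [← hvel]
  exact hasDerivWithinAt_extChartAt_comp (c := fun r ↦ (γ r).proj)
    (((contMDiffAt_proj (TangentSpace I : M → Type _) (n := ∞)).mdifferentiableAt
      (by simp)).comp_mdifferentiableWithinAt t hγ) hx

lemma hasDerivWithinAt_fiberCoord_of_velocity_eq_geodesicSpray
    (hγ : MDifferentiableWithinAt 𝓘(ℝ, ℝ) I.tangent γ s t)
    (hZ : velocity γ s t = geodesicSpray cov (γ t)) (hx : (γ t).proj ∈ (chartAt H x₀).source) :
    HasDerivWithinAt (fun r ↦ fiberCoord x₀ (γ r).proj (γ r).2)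
      (-chartChristoffel cov x₀ (extChartAt I x₀ (γ t).proj) (fiberCoord x₀ (γ t).proj (γ t).2)
        (fiberCoord x₀ (γ t).proj (γ t).2)) s t := by
  have h := hasDerivWithinAt_fiberCoord_comp hγ hx
  rw [hZ, geodesicSpray, fiberCoordDeriv_horizontalLift hx] at h
  rwa [chartChristoffel_extChartAt hx, constField_fiberCoord hx]

lemma IsGeodesicOn.velocity_velocity (hc : IsGeodesicOn cov c s) (hs : UniqueDiffOn ℝ s)
    (ht : t ∈ s) :
    velocity (fun r ↦ (⟨c r, velocity c s r⟩ : TangentBundle I M)) s t =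
      geodesicSpray cov ⟨c t, velocity c s t⟩ := by
  have hvert : verticalLift ⟨c t, velocity c s t⟩ (0 : TangentSpace I (c t)) = 0 :=
    verticalLift_eq (I := I) (c t) (velocity (I := I) c s t : E) (0 : E)
  rw [velocity_eq_horizontalLift_add_verticalLift (cov := cov) (hs t ht)
    ((contMDiffOn_velocity hs hc.contMDiffOn t ht).mdifferentiableWithinAt (by simp)),
    hc.covDerivAlong_velocity t ht, hvert, add_zero, geodesicSpray]

lemma IsGeodesicOn.isGeodesicSolutionOn {s' : Set ℝ} (hc : IsGeodesicOn cov c s)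
    (hs : UniqueDiffOn ℝ s) (hs' : s' ⊆ s) (hcs' : MapsTo c s' (chartAt H x₀).source) :
    IsGeodesicSolutionOn (chartChristoffel cov x₀) (fun r ↦ extChartAt I x₀ (c r))
      (fun r ↦ fiberCoord (I := I) x₀ (c r) (velocity c s r)) s' := by
  have hγ : MDifferentiableOn 𝓘(ℝ, ℝ) I.tangent
      (fun r ↦ (⟨c r, velocity c s r⟩ : TangentBundle I M)) s :=
    (contMDiffOn_velocity hs hc.contMDiffOn).mdifferentiableOn (by simp)
  exact ⟨fun t ht ↦ (hasDerivWithinAt_extChartAt_of_velocity_eq_geodesicSpray (hs t (hs' ht))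
      (hγ t (hs' ht)) (hc.velocity_velocity hs (hs' ht)) (hcs' ht)).mono hs',
    fun t ht ↦ (hasDerivWithinAt_fiberCoord_of_velocity_eq_geodesicSpray
      (hγ t (hs' ht)) (hc.velocity_velocity hs (hs' ht)) (hcs' ht)).mono hs'⟩

lemma IsGeodesicSolutionOn.isGeodesicOn (h : IsGeodesicSolutionOn (chartChristoffel cov x₀) x v s)
    (hs : UniqueDiffOn ℝ s) (hx : ContDiffOn ℝ ∞ x s) (hxs : MapsTo x s (extChartAt I x₀).target) :
    IsGeodesicOn cov (fun t ↦ (extChartAt I x₀).symm (x t)) s := by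
  let c : ℝ → M := fun t ↦ (extChartAt I x₀).symm (x t)
  have hsource : ∀ t ∈ s, c t ∈ (chartAt H x₀).source := fun t ht ↦
    extChartAt_source I x₀ ▸ (extChartAt I x₀).map_target (hxs ht)
  have hc : ContMDiffOn 𝓘(ℝ, ℝ) I ∞ c s :=
    (contMDiffOn_extChartAt_symm x₀).comp hx.contMDiffOn hxs
  have hvel : ∀ t ∈ s, fiberCoord x₀ (c t) (velocity c s t) = v t := fun t ht ↦ by
    rw [velocity_extChartAt_symm_comp (hs t ht) hxs ht (h.hasDerivWithinAt_position t ht)]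
    exact fiberCoord_constField (hsource t ht) _
  refine ⟨hc, fun t ht ↦ fiberCoord_injective (hsource t ht) ?_⟩
  have hγ := (contMDiffOn_velocity hs hc t ht).mdifferentiableWithinAt (by simp)
  have hderiv := (hs t ht).eq_deriv _ ((hasDerivWithinAt_fiberCoord_comp hγ (hsource t ht)).congr
    (fun r hr ↦ (hvel r hr).symm) (hvel t ht).symm) (h.hasDerivWithinAt_velocity t ht)
  rw [velocity_eq_horizontalLift_add_verticalLift (cov := cov) (hs t ht) hγ, map_add,
    fiberCoordDeriv_verticalLift (hsource t ht), fiberCoordDeriv_horizontalLift (hsource t ht)]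
    at hderiv
  have hx_c : x t = extChartAt I x₀ (c t) := ((extChartAt I x₀).right_inv (hxs ht)).symm
  rw [hx_c, ← hvel t ht, chartChristoffel_extChartAt (hsource t ht),
    constField_fiberCoord (hsource t ht)] at hderiv
  rw [map_zero]
  exact add_eq_left.1 hderiv

end GeodesicFlow

section InvariantDistributions

variable {E : Type*} [NormedAddCommGroup E] [NormedSpace ℝ E]
  {H : Type*} [TopologicalSpace H] {I : ModelWithCorners ℝ E H}
  {M : Type*} [TopologicalSpace M] [ChartedSpace H M] [IsManifold I ∞ M]
  {cov : CovariantDerivative I E (TangentSpace I : M → Type _)}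
  {D : (x : M) → Submodule ℝ (TangentSpace I x)} {x₀ y : M}

lemma IsTangentTo.exists_velocity_eq {Z : (v : TangentBundle I M) → TangentSpace I.tangent v}
    {S : Set (TangentBundle I M)} (hZ : IsTangentTo Z S) {v : TangentBundle I M} (hv : v ∈ S) :
    ∃ γ : ℝ → TangentBundle I M, γ 0 = v ∧ MDifferentiableAt 𝓘(ℝ, ℝ) I.tangent γ 0 ∧
      (∀ᶠ t in 𝓝 0, γ t ∈ S) ∧ velocity γ univ 0 = Z (γ 0) := by
  obtain ⟨ε, γ, hε, rfl, hγ, hmem, hderiv⟩ := hZ v hv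
  have hnhds : Ioo (-ε) ε ∈ 𝓝 (0 : ℝ) := Ioo_mem_nhds (neg_neg_iff_pos.2 hε) hε
  refine ⟨γ, rfl, (hγ.contMDiffAt hnhds).mdifferentiableAt (by simp),
    Filter.eventually_of_mem hnhds hmem, ?_⟩
  rw [velocity, mfderivWithin_univ]
  exact hderiv

lemma mem_span_range_fiberCoord_iff (hy : y ∈ (chartAt H x₀).source) {ι : Type*}
    {X : ι → TangentSpace I y} {w : E} :
    w ∈ Submodule.span ℝ (range fun i ↦ fiberCoord x₀ y (X i)) ↔
      constField x₀ w y ∈ Submodule.span ℝ (range X) := by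
  let f : TangentSpace I y →ₗ[ℝ] E := (fiberCoord (I := I) x₀ y).toLinearMap
  have hmap : Submodule.span ℝ (range fun i ↦ fiberCoord x₀ y (X i)) =
      (Submodule.span ℝ (range X)).map f := by
    rw [Submodule.map_span, ← range_comp]
    rfl
  rw [hmap]
  constructor
  · rintro ⟨w', hw', rfl⟩
    exact (constField_fiberCoord hy w').symm ▸ hw'
  · exact fun hw ↦ ⟨_, hw, fiberCoord_constField hy w⟩

/-- In the chart at `x₀`, the distribution `D` is near the point with coordinates `z` the kernel of
the projections `A z'`, which depend on `z'` in a `C¹` way. Thus `A x v = 0` are (redundant) local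
equations for `D` in the induced coordinates of `TM`. -/
structure IsLocalDefiningProjection (D : (x : M) → Submodule ℝ (TangentSpace I x)) (x₀ : M)
    (A : E → E →L[ℝ] E) (z : E) : Prop where
  contDiffAt : ContDiffAt ℝ 1 A z
  eventually_isIdempotentElem : ∀ᶠ z' in 𝓝 z, IsIdempotentElem (A z')
  eventually_apply_eq_zero_iff : ∀ᶠ z' in 𝓝 z, ∀ w, A z' w = 0 ↔
    constField x₀ w ((extChartAt I x₀).symm z') ∈ D ((extChartAt I x₀).symm z')

namespace IsLocalDefiningProjection

variable {A : E → E →L[ℝ] E}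

lemma eventually {z : E} (hA : IsLocalDefiningProjection D x₀ A z) :
    ∀ᶠ z' in 𝓝 z, IsLocalDefiningProjection D x₀ A z' := by
  filter_upwards [hA.contDiffAt.eventually (by simp),
    hA.eventually_isIdempotentElem.eventually_nhds,
    hA.eventually_apply_eq_zero_iff.eventually_nhds] with z' hsmooth hidem hker
  exact ⟨hsmooth, hidem, hker⟩

lemma apply_constField_eq_zero_iff (hA : IsLocalDefiningProjection D x₀ A (extChartAt I x₀ y))
    (hy : y ∈ (chartAt H x₀).source) (w : E) :
    A (extChartAt I x₀ y) w = 0 ↔ constField x₀ w y ∈ D y := by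
  have h := hA.eventually_apply_eq_zero_iff.self_of_nhds w
  rwa [(extChartAt I x₀).left_inv (by rwa [extChartAt_source])] at h

lemma apply_fiberCoord_eq_zero_iff (hA : IsLocalDefiningProjection D x₀ A (extChartAt I x₀ y))
    (hy : y ∈ (chartAt H x₀).source) (w : TangentSpace I y) :
    A (extChartAt I x₀ y) (fiberCoord x₀ y w) = 0 ↔ w ∈ D y := by
  rw [hA.apply_constField_eq_zero_iff hy, constField_fiberCoord hy]

end IsLocalDefiningProjection

variable [FiniteDimensional ℝ E]

lemma IsSmoothDistribution.exists_isLocalDefiningProjection [I.Boundaryless] {p : ℕ}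
    (hD : IsSmoothDistribution D p) (x₀ : M) :
    ∃ A, IsLocalDefiningProjection D x₀ A (extChartAt I x₀ x₀) := by
  obtain ⟨U, hU, hxU, X, hX, hspan⟩ := hD x₀
  have hx₀ := mem_chart_source H x₀
  have hψ₀ : (extChartAt I x₀).symm (extChartAt I x₀ x₀) = x₀ := extChartAt_to_inv x₀
  have hψ : ContMDiffAt 𝓘(ℝ, E) I ∞ (extChartAt I x₀).symm (extChartAt I x₀ x₀) :=
    (contMDiffOn_extChartAt_symm x₀).contMDiffAt (extChartAt_target_mem_nhds x₀)
  let ξ : Fin p → M → E := fun i y ↦ fiberCoord x₀ y (X i y)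
  have hξ : ∀ i, ContMDiffAt I 𝓘(ℝ, E) ∞ (ξ i) x₀ := fun i ↦
    (contMDiffAt_fiberCoord (v := (⟨x₀, X i x₀⟩ : TangentBundle I M)) hx₀).comp x₀
      ((hX i).contMDiffAt (hU.mem_nhds hxU))
  have hξψ : ∀ i, ContDiffAt ℝ 1 (ξ i ∘ (extChartAt I x₀).symm) (extChartAt I x₀ x₀) := fun i ↦
    ((hξ i).comp_of_eq hψ hψ₀).contDiffAt.of_le (by norm_cast)
  have hli : LinearIndependent ℝ fun i ↦ ξ i ((extChartAt I x₀).symm (extChartAt I x₀ x₀)) := by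
    rw [hψ₀]
    exact (hspan x₀ hxU).1.map_injOn (fiberCoord (I := I) x₀ x₀).toLinearMap
      (fiberCoord_injective hx₀).injOn
  obtain ⟨A, hA, hA'⟩ := exists_contDiffAt_projection_ker_eq_span hξψ hli
  refine ⟨A, hA, hA'.mono fun z hz ↦ hz.1, ?_⟩
  filter_upwards [hA', extChartAt_target_mem_nhds x₀,
    hψ.continuousAt.eventually_mem (hU.mem_nhds (hψ₀.symm ▸ hxU))] with z hz hzt hzU w
  rw [(hspan _ hzU).2]
  exact (hz.2 w).trans (mem_span_range_fiberCoord_iff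
    (extChartAt_source I x₀ ▸ (extChartAt I x₀).map_target hzt))

lemma IsTangentTo.invarianceDefect_eq_zero {A : E → E →L[ℝ] E} {v : TangentBundle I M}
    (hZ : IsTangentTo (geodesicSpray cov) (totalSet D)) (hv : v ∈ totalSet D)
    (hx : v.proj ∈ (chartAt H x₀).source)
    (hA : IsLocalDefiningProjection D x₀ A (extChartAt I x₀ v.proj)) :
    invarianceDefect (chartChristoffel cov x₀) A (extChartAt I x₀ v.proj)
      (fiberCoord x₀ v.proj v.2) (fiberCoord x₀ v.proj v.2) = 0 := by
  obtain ⟨γ, rfl, hγ, hmem, hvel⟩ := hZ.exists_velocity_eq hv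
  have hposition := hasDerivWithinAt_extChartAt_of_velocity_eq_geodesicSpray
    uniqueDiffWithinAt_univ hγ.mdifferentiableWithinAt hvel hx
  have hvelocity := hasDerivWithinAt_fiberCoord_of_velocity_eq_geodesicSpray
    hγ.mdifferentiableWithinAt hvel hx
  have hderiv := hasDerivWithinAt_clm_apply_velocity (x := fun r ↦ extChartAt I x₀ (γ r).proj)
    (v := fun r ↦ fiberCoord (I := I) x₀ (γ r).proj (γ r).2)
    (hA.contDiffAt.differentiableAt one_ne_zero) hposition hvelocity
  refine (hasDerivWithinAt_univ.1 hderiv).unique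
    ((hasDerivAt_const (0 : ℝ) (0 : E)).congr_of_eventuallyEq ?_)
  have hproj : ContinuousAt (fun t ↦ (γ t).proj) 0 :=
    (FiberBundle.continuous_proj E (TangentSpace I : M → Type _)).continuousAt.comp
      hγ.continuousAt
  filter_upwards [hmem,
    (hasDerivWithinAt_univ.1 hposition).continuousAt.eventually hA.eventually,
    hproj.eventually_mem ((chartAt H x₀).open_source.mem_nhds hx)] with t htD htA hts
  exact (htA.apply_fiberCoord_eq_zero_iff hts _).2 htD

variable {c : ℝ → M} {s : Set ℝ} {a b t₀ t : ℝ}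

lemma GeodesicallyInvariant.constField_mem {x v : ℝ → E} (hD : GeodesicallyInvariant cov D)
    (hab : a < b) (h : IsGeodesicSolutionOn (chartChristoffel cov x₀) x v (Icc a b))
    (hx : ContDiffOn ℝ ∞ x (Icc a b)) (hxs : MapsTo x (Icc a b) (extChartAt I x₀).target)
    (ha : constField x₀ (v a) ((extChartAt I x₀).symm (x a)) ∈ D ((extChartAt I x₀).symm (x a))) :
    constField x₀ (v b) ((extChartAt I x₀).symm (x b)) ∈ D ((extChartAt I x₀).symm (x b)) := by
  have hs := uniqueDiffOn_Icc hab
  have hvel : ∀ t ∈ Icc a b, velocity (I := I) (fun r ↦ (extChartAt I x₀).symm (x r)) (Icc a b) t =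
      constField x₀ (v t) ((extChartAt I x₀).symm (x t)) := fun t ht ↦
    velocity_extChartAt_symm_comp (hs t ht) hxs ht (h.hasDerivWithinAt_position t ht)
  rw [← hvel a (left_mem_Icc.2 hab.le)] at ha
  rw [← hvel b (right_mem_Icc.2 hab.le)]
  exact hD a b _ hab (h.isGeodesicOn hs hx hxs) ha b (right_mem_Icc.2 hab.le)

lemma GeodesicallyInvariant.constField_mem_of_mem_Ioo {ε : ℝ} {x v : ℝ → E}
    (hD : GeodesicallyInvariant cov D)
    (h : IsGeodesicSolutionOn (chartChristoffel cov x₀) x v (Ioo (-ε) ε))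
    (hx : ContDiffOn ℝ ∞ x (Ioo (-ε) ε)) (hxs : MapsTo x (Ioo (-ε) ε) (extChartAt I x₀).target)
    (h₀ : constField x₀ (v 0) ((extChartAt I x₀).symm (x 0)) ∈ D ((extChartAt I x₀).symm (x 0)))
    (ht : t ∈ Ioo (-ε) ε) :
    constField x₀ (v t) ((extChartAt I x₀).symm (x t)) ∈ D ((extChartAt I x₀).symm (x t)) := by
  have hε : 0 < ε := by linarith [ht.1, ht.2]
  rcases lt_trichotomy t 0 with hneg | rfl | hpos
  · have hsub : Icc 0 (-t) ⊆ Neg.neg ⁻¹' Ioo (-ε) ε := fun r hr ↦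
      ⟨by linarith [ht.1, hr.2], by linarith [hr.1]⟩
    have hreverse := hD.constField_mem (neg_pos.2 hneg) (h.comp_neg.mono hsub)
      (hx.comp contDiff_neg.contDiffOn hsub) (hxs.comp hsub)
    have hneg_mem (u : E) (y : M) : constField x₀ (-u) y ∈ D y ↔ constField x₀ u y ∈ D y := by
      rw [← neg_one_smul ℝ u, constField_smul, Pi.smul_apply, neg_one_smul, neg_mem_iff]
    rw [hneg_mem, hneg_mem, neg_zero, neg_neg] at hreverse
    exact hreverse h₀
  · exact h₀
  · have hsub : Icc 0 t ⊆ Ioo (-ε) ε := fun r hr ↦ ⟨by linarith [hr.1], hr.2.trans_lt ht.2⟩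
    exact hD.constField_mem hpos (h.mono hsub) (hx.mono hsub) (hxs.mono_left hsub) h₀

variable [I.Boundaryless] [T2Space M] [CovariantDerivative.ContMDiffCovariantDerivative cov ∞]

lemma IsGeodesicOn.velocity_mem {A : E → E →L[ℝ] E}
    (hc : IsGeodesicOn cov c s) (hs : UniqueDiffOn ℝ s)
    (hZ : IsTangentTo (geodesicSpray cov) (totalSet D)) (hab : Icc a b ⊆ s)
    (hsource : MapsTo c (Icc a b) (chartAt H x₀).source)
    (hA : ∀ t ∈ Icc a b, IsLocalDefiningProjection D x₀ A (extChartAt I x₀ (c t)))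
    (ht₀ : t₀ ∈ Icc a b) (h₀ : velocity c s t₀ ∈ D (c t₀)) (ht : t ∈ Icc a b) :
    velocity c s t ∈ D (c t) := by
  have hΓ : ∀ t ∈ Icc a b, ContinuousAt (chartChristoffel cov x₀) (extChartAt I x₀ (c t)) :=
    fun t ht ↦ (contDiffOn_chartChristoffel x₀).continuousOn.continuousAt
      ((isOpen_extChartAt_target x₀).mem_nhds ((extChartAt I x₀).map_source
        (by simpa only [extChartAt_source] using hsource ht)))
  rw [← (hA t ht).apply_fiberCoord_eq_zero_iff (hsource ht)]
  refine (hc.isGeodesicSolutionOn hs hab hsource).apply_eq_zero hΓ (fun t ht ↦ (hA t ht).contDiffAt)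
    (fun t ht ↦ (hA t ht).eventually_isIdempotentElem.self_of_nhds) (fun t ht w hw ↦ ?_) ht₀
    (((hA t₀ ht₀).apply_fiberCoord_eq_zero_iff (hsource ht₀) _).2 h₀) ht
  have hmem := ((hA t ht).apply_constField_eq_zero_iff (hsource ht) w).1 hw
  simpa only [fiberCoord_constField (hsource ht)] using
    hZ.invarianceDefect_eq_zero (v := ⟨c t, constField x₀ w (c t)⟩) hmem (hsource ht) (hA t ht)

lemma IsGeodesicOn.eventually_velocity_mem_iff {p : ℕ} (hc : IsGeodesicOn cov c (Icc a b))
    (hD : IsSmoothDistribution D p) (hZ : IsTangentTo (geodesicSpray cov) (totalSet D))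
    (hab : a < b) (ht₀ : t₀ ∈ Icc a b) :
    ∀ᶠ t in 𝓝[Icc a b] t₀,
      velocity c (Icc a b) t₀ ∈ D (c t₀) ↔ velocity c (Icc a b) t ∈ D (c t) := by
  obtain ⟨A, hA⟩ := hD.exists_isLocalDefiningProjection (c t₀)
  have hcont : ContinuousWithinAt c (Icc a b) t₀ := hc.contMDiffOn.continuousOn t₀ ht₀
  have hsource : ∀ᶠ t in 𝓝[Icc a b] t₀, c t ∈ (chartAt H (c t₀)).source :=
    hcont.eventually_mem ((chartAt H (c t₀)).open_source.mem_nhds (mem_chart_source H (c t₀)))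
  have hproj : ∀ᶠ t in 𝓝[Icc a b] t₀,
      IsLocalDefiningProjection D (c t₀) A (extChartAt I (c t₀) (c t)) :=
    ((continuousAt_extChartAt (I := I) (c t₀)).comp_continuousWithinAt hcont).eventually
      hA.eventually
  have hgood : ∀ᶠ r in 𝓝[Icc a b] t₀, r ∈ Icc a b ∧ c r ∈ (chartAt H (c t₀)).source ∧
      IsLocalDefiningProjection D (c t₀) A (extChartAt I (c t₀) (c r)) :=
    eventually_mem_nhdsWithin.and (hsource.and hproj)
  have htendsto : Filter.Tendsto (fun t ↦ uIcc t₀ t) (𝓝[Icc a b] t₀) (𝓝[Icc a b] t₀).smallSets :=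
    (Filter.tendsto_const_pure.mono_right (pure_le_nhdsWithin ht₀)).uIcc Filter.tendsto_id
  filter_upwards [htendsto.eventually (Filter.eventually_smallSets_forall.2 hgood)] with t ht
  have hmem {r r' : ℝ} (hr : r ∈ uIcc t₀ t) (hr' : r' ∈ uIcc t₀ t)
      (h : velocity c (Icc a b) r ∈ D (c r)) : velocity c (Icc a b) r' ∈ D (c r') :=
    hc.velocity_mem (uniqueDiffOn_Icc hab) hZ (fun r hr ↦ (ht r hr).1) (fun r hr ↦ (ht r hr).2.1)
      (fun r hr ↦ (ht r hr).2.2) hr h hr'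
  exact ⟨hmem left_mem_uIcc right_mem_uIcc, hmem right_mem_uIcc left_mem_uIcc⟩

theorem IsSmoothDistribution.geodesicallyInvariant {p : ℕ} (hD : IsSmoothDistribution D p)
    (hZ : IsTangentTo (geodesicSpray cov) (totalSet D)) : GeodesicallyInvariant cov D := by
  intro a b c hab hc ha t ht
  refine isPreconnected_Icc.induction₂'
    (fun r r' ↦ velocity c (Icc a b) r ∈ D (c r) → velocity c (Icc a b) r' ∈ D (c r'))
    (fun r hr ↦ (hc.eventually_velocity_mem_iff hD hZ hab hr).mono fun r' h ↦ ⟨h.1, h.2⟩)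
    (fun _ _ _ _ _ _ h h' ↦ h' ∘ h) (left_mem_Icc.2 hab.le) ht ha

lemma GeodesicallyInvariant.exists_isGeodesicOn_Ioo (hD : GeodesicallyInvariant cov D)
    {v : TangentBundle I M} (hv : v ∈ totalSet D) :
    ∃ ε > 0, ∃ c : ℝ → M, IsGeodesicOn cov c (Ioo (-ε) ε) ∧
      (⟨c 0, velocity c (Ioo (-ε) ε) 0⟩ : TangentBundle I M) = v ∧
      ∀ t ∈ Ioo (-ε) ε, velocity c (Ioo (-ε) ε) t ∈ D (c t) := by
  obtain ⟨x₀, w⟩ := v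
  have : CompleteSpace E := FiniteDimensional.complete ℝ E
  obtain ⟨ε, hε, x, v, hx₀, hv₀, hx, hxs, h⟩ :=
    exists_isGeodesicSolutionOn_Ioo (isOpen_extChartAt_target x₀)
      (contDiffOn_chartChristoffel (cov := cov) x₀) (mem_extChartAt_target x₀)
      (fiberCoord (I := I) x₀ x₀ w)
  let c : ℝ → M := fun t ↦ (extChartAt I x₀).symm (x t)
  have hs : UniqueDiffOn ℝ (Ioo (-ε) ε) := isOpen_Ioo.uniqueDiffOn
  have hvel : ∀ t ∈ Ioo (-ε) ε, velocity c (Ioo (-ε) ε) t = constField x₀ (v t) (c t) :=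
    fun t ht ↦ velocity_extChartAt_symm_comp (hs t ht) hxs ht (h.hasDerivWithinAt_position t ht)
  have hc₀ : c 0 = x₀ := (congrArg _ hx₀).trans (extChartAt_to_inv x₀)
  have hinit : (⟨c 0, constField x₀ (v 0) (c 0)⟩ : TangentBundle I M) = ⟨x₀, w⟩ := by
    rw [hc₀, hv₀, constField_fiberCoord (mem_chart_source H x₀)]
  have h₀ : constField x₀ (v 0) (c 0) ∈ D (c 0) :=
    (hinit ▸ hv : (⟨c 0, constField x₀ (v 0) (c 0)⟩ : TangentBundle I M) ∈ totalSet D)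
  refine ⟨ε, hε, c, h.isGeodesicOn hs hx hxs, ?_, fun t ht ↦ ?_⟩
  · rw [hvel 0 ⟨neg_neg_iff_pos.2 hε, hε⟩, hinit]
  · rw [hvel t ht]
    exact hD.constField_mem_of_mem_Ioo h hx hxs h₀ ht

theorem GeodesicallyInvariant.isTangentTo (hD : GeodesicallyInvariant cov D) :
    IsTangentTo (geodesicSpray cov) (totalSet D) := by
  intro v hv
  obtain ⟨ε, hε, c, hc, rfl, hmem⟩ := hD.exists_isGeodesicOn_Ioo hv
  have hs : UniqueDiffOn ℝ (Ioo (-ε) ε) := isOpen_Ioo.uniqueDiffOn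
  have h₀ : (0 : ℝ) ∈ Ioo (-ε) ε := ⟨neg_neg_iff_pos.2 hε, hε⟩
  refine ⟨ε, fun t ↦ ⟨c t, velocity c (Ioo (-ε) ε) t⟩, hε, rfl,
    contMDiffOn_velocity hs hc.contMDiffOn, hmem, ?_⟩
  rw [← hc.velocity_velocity hs h₀, velocity, mfderivWithin_of_mem_nhds (isOpen_Ioo.mem_nhds h₀)]

end InvariantDistributions

end GeodesicInvariance
end

theorem mainTheorem8_general {E : Type*} [NormedAddCommGroup E] [NormedSpace ℝ E]
    [FiniteDimensional ℝ E] {H : Type*} [TopologicalSpace H] {I : ModelWithCorners ℝ E H}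
    [I.Boundaryless] {M : Type*} [TopologicalSpace M] [T2Space M] [ChartedSpace H M]
    [IsManifold I ∞ M] (cov : CovariantDerivative I E (TangentSpace I : M → Type _))
    [CovariantDerivative.ContMDiffCovariantDerivative cov ∞]
    (p : ℕ) (D : (x : M) → Submodule ℝ (TangentSpace I x))
    (hD : GeodesicInvariance.IsSmoothDistribution D p) :
    GeodesicInvariance.GeodesicallyInvariant cov D ↔
      GeodesicInvariance.IsTangentTo (GeodesicInvariance.geodesicSpray cov)
        (GeodesicInvariance.totalSet D) :=
  ⟨fun h ↦ h.isTangentTo, fun h ↦ hD.geodesicallyInvariant h⟩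

theorem mainTheorem8 {n : ℕ}
    {M : Type*} [TopologicalSpace M] [T2Space M] [ChartedSpace (EuclideanSpace ℝ (Fin n)) M]
    [IsManifold (𝓡 n) ∞ M]
    (cov : CovariantDerivative (𝓡 n) (EuclideanSpace ℝ (Fin n))
      (TangentSpace (𝓡 n) : M → Type _))
    [CovariantDerivative.ContMDiffCovariantDerivative cov ∞]
    (p : ℕ) (D : (x : M) → Submodule ℝ (TangentSpace (𝓡 n) x))
    (hD : GeodesicInvariance.IsSmoothDistribution D p) :
    GeodesicInvariance.GeodesicallyInvariant cov D ↔
      GeodesicInvariance.IsTangentTo (GeodesicInvariance.geodesicSpray cov)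
        (GeodesicInvariance.totalSet D) :=
  mainTheorem8_general cov p D hD
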